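/- Let $n\ge 0$, $[n]=\{1,\dots,n\}$, let $\mathcal I_k$ be the set of $k$-element subsets of $[n]$ for $0\le k\le n$, and $\bar I=[n]\setminus I$. Let $\mathcal L=\mathcal L_{\lambda,\mathbf z,y}$ be the ring of rational functions $f/g$ with $f\in\mathbb C[\lambda,z_1,\dots,z_n,y]$ and $g$ a finite product of factors $z_i-z_j$ ($i\ne j$), $z_i-z_j-y$ (all $i,j$) and $\lambda+ly$ ($l\in\mathbb Z$). **Cohomology.** Let $T=(\mathbb C^\times)^n\times\mathbb C^\times$ and use the standard presentation $$H^*_T(T^*\mathrm{Gr}_k(\mathbb C^n))=\mathbb C[\Gamma,\mathbf z,y]^{S_k\times S_{n-k}}\Big/\Big(\prod_{i=1}^k(u-\gamma_{1,i})\prod_{j=1}^{n-k}(u-\gamma_{2,j})-\prod_{a=1}^n(u-z_a)\Big),\qquad \Gamma=\{\gamma_{1,1},\dots,\gamma_{1,k},\gamma_{2,1},\dots,\gamma_{2,n-k}\},$$ where the coefficient of every power of $u$ is a relation. Put $\mathcal X_n=\coprod_{k=0}^nT^*\mathrm{Gr}_k(\mathbb C^n)$, so that $H^*_T(\mathcal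 X_n)\otimes\mathcal L=\bigoplus_{k=0}^nH^*_T(T^*\mathrm{Gr}_k(\mathbb C^n))\otimes_{\mathbb C[\mathbf z,y]}\mathcal L$. For $I\in\mathcal I_k$ the restriction of $[f(\lambda,\Gamma,\mathbf z,y)]$ to the fixed point $x_I$ is $f(\lambda,\mathbf z_I,\mathbf z,y)$, obtained by $\{\gamma_{1,*}\}\mapsto\{z_a\}_{a\in I}$, $\{\gamma_{2,*}\}\mapsto\{z_a\}_{a\in\bar I}$. Similarly, a function of $t_1,\dots,t_k$ is evaluated at $\mathbf z_I$ by substituting the $z_a$, $a\in I$, for the $t_r$. **Weight functions.** For $i\in I$ let $w(i,I)=-\#\{j>i:j\in\bar I\}+\#\{j>i:j\in I\}$. For $I=\{i_1<\dots<i_k\}$ let $l_I(r,a)$ be $t_r-z_a+y$ if $a<i_r$, $\lambda+t_r-z_a-w(i_r,I)y$ if $a=i_r$, and $t_r-z_a$ if $a>i_r$. Put $$W_I(\lambda,\mathbf t,\mathbf z,y)=y^k\,\mathrm{Sym}_{t_1,\dots,t_k}\Big(\prod_{r=1}^k\prod_{a=1}^nl_I(r,a)\prod_{1\le a<b\le k}\frac{t_a-t_b+y}{t_a-t_b}\Big),\qquad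 W_{\sigma,I}(\lambda,\mathbf t,\mathbf z,y)=W_{\sigma^{-1}(I)}(\lambda,\mathbf t,z_{\sigma(1)},\dots,z_{\sigma(n)},y),$$ where $\sigma\in S_n$ and $\mathrm{Sym}$ is the sum over all permutations of the $t_r$. With $e_k=\prod_{a,b=1}^k(t_a-t_b+y)$, $C^{(r)}_I=\prod_{i\in I}(\lambda-(w(i,I)+r)y)$ and $s_0$ the longest permutation in $S_n$, put $$\tilde W^+_I=\frac{W_I}{C^{(0)}_IC^{(1)}_Ie_k},\qquad \tilde W^-_I=\frac{(-1)^k}{e_k}W_{s_0,I}(-\lambda-(n-2k)y,\mathbf t,\mathbf z,y).$$ Put $R_I(\mathbf z)=\prod_{a\in I,\,b\in\bar I}(z_a-z_b)$ and $Q_I(\mathbf z,y)=\prod_{a\in I,\,b\in\bar I}(z_a-z_b+y)$. **Maps.** Let $v_1,v_2$ be the standard basis of $\mathbb C^2$ and $v_I=v_{i_1}\otimes\dots\otimes v_{i_n}\in(\mathbb C^2)^{\otimes n}$ with $i_j=1$ for $j\in I$ and $i_j=2$ for $j\in\bar I$. The dynamical stable envelope map $\mathrm{Stab}_{\mathrm{id}}:(\mathbb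 C^2)^{\otimes n}\otimes\mathcal L\to H^*_T(\mathcal X_n)\otimes\mathcal L$ is the $\mathcal L$-linear map with $v_I\mapsto\kappa_I$ for $I\in\mathcal I_k$, $0\le k\le n$, where $\kappa_I\in H^*_T(T^*\mathrm{Gr}_k(\mathbb C^n))\otimes\mathcal L$ is the class with $\kappa_I|_{x_J}=\tilde W^+_I(\lambda,\mathbf z_J,\mathbf z,y)$ for all $J\in\mathcal I_k$. For $I\in\mathcal I_k$ let $\xi_I=\frac1{Q_I(\mathbf z,y)}\sum_{J\in\mathcal I_k}\tilde W^-_J(\lambda,\mathbf z_I,\mathbf z,y)\,v_J$. Let $\nu:H^*_T(\mathcal X_n)\otimes\mathcal L\to(\mathbb C^2)^{\otimes n}\otimes\mathcal L$ be the $\mathcal L$-linear map with $$\nu([f(\lambda,\Gamma,\mathbf z,y)])=\sum_{I\in\mathcal I_k}\frac{f(\lambda,\mathbf z_I,\mathbf z,y)}{R_I(\mathbf z)}\,\xi_I\qquad\text{for }[f]\in H^*_T(T^*\mathrm{Gr}_k(\mathbb C^n))\otimes\mathcal L,\ 0\le k\le n.$$ **Theorem.** The map $\nu$, given by this formula, and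 $\mathrm{Stab}_{\mathrm{id}}$ are mutually inverse isomorphisms of $\mathcal L$-modules: $\nu\circ\mathrm{Stab}_{\mathrm{id}}=\mathrm{id}$ and $\mathrm{Stab}_{\mathrm{id}}\circ\nu=\mathrm{id}$. Consequently, for all $0\le k\le n$ and $I\in\mathcal I_k$, $$\mathrm{Stab}_{\mathrm{id}}(\xi_I)=\Big[\prod_{i=1}^k\prod_{j\in\bar I}(\gamma_{1,i}-z_j)\Big].$$ -/

import Mathlib

open scoped TensorProduct

noncomputable section

namespace DynStab

/-! ### Coefficient rings -/

/-- The polynomial ring `ℂ[z, y]`, with variables `z₁, …, zₙ` and `y`. -/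
abbrev P (n : ℕ) : Type := MvPolynomial (Fin n ⊕ Unit) ℂ

/-- The variable `z_a` of `ℂ[z, y]`. -/
def zP {n : ℕ} (a : Fin n) : P n := MvPolynomial.X (Sum.inl a)

/-- The variable `y` of `ℂ[z, y]`. -/
def yP (n : ℕ) : P n := MvPolynomial.X (Sum.inr ())

/-- The admissible denominators in `ℂ[λ, z, y] = ℂ[z, y][λ]`: all finite products of factors
`z_i - z_j` (`i ≠ j`), `z_i - z_j - y` (all `i`, `j`) and `λ + l y` (`l ∈ ℤ`). -/
def denominators (n : ℕ) : Submonoid (Polynomial (P n)) :=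
  Submonoid.closure
    ({p | ∃ i j : Fin n, i ≠ j ∧ p = Polynomial.C (zP i - zP j)} ∪
      {p | ∃ i j : Fin n, p = Polynomial.C (zP i - zP j - yP n)} ∪
      {p | ∃ l : ℤ, p = Polynomial.X + Polynomial.C ((l : P n) * yP n)})

/-- The algebra `𝓛_{λ,z,y} = 𝓛_{λ,y} ⊗_{ℂ[y]} 𝓛_{z,y}` of rational functions in `λ, z, y` with the
admissible denominators. -/
def L (n : ℕ) : Type := Localization (denominators n)

instance instCommRingL (n : ℕ) : CommRing (L n) :=
  inferInstanceAs (CommRing (Localization (denominators n)))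

instance instAlgebraPolyL (n : ℕ) : Algebra (Polynomial (P n)) (L n) :=
  inferInstanceAs (Algebra (Polynomial (P n)) (Localization (denominators n)))

instance instIsLocalizationL (n : ℕ) : IsLocalization (denominators n) (L n) :=
  inferInstanceAs (IsLocalization (denominators n) (Localization (denominators n)))

instance instAlgebraL (n : ℕ) : Algebra (P n) (L n) :=
  inferInstanceAs (Algebra (P n) (Localization (denominators n)))

instance instScalarTowerL (n : ℕ) : IsScalarTower (P n) (Polynomial (P n)) (L n) :=
  inferInstanceAs (IsScalarTower (P n) (Polynomial (P n)) (Localization (denominators n)))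

instance instAlgebraComplexL (n : ℕ) : Algebra ℂ (L n) :=
  inferInstanceAs (Algebra ℂ (Localization (denominators n)))

instance instScalarTowerComplexL (n : ℕ) : IsScalarTower ℂ (P n) (L n) :=
  inferInstanceAs (IsScalarTower ℂ (P n) (Localization (denominators n)))

/-- `z_a` as an element of `𝓛_{λ,z,y}`. -/
def z {n : ℕ} (a : Fin n) : L n := algebraMap (P n) (L n) (zP a)

/-- `y` as an element of `𝓛_{λ,z,y}`. -/
def y (n : ℕ) : L n := algebraMap (P n) (L n) (yP n)

/-- `λ` as an element of `𝓛_{λ,z,y}`. -/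
def lam (n : ℕ) : L n := algebraMap (Polynomial (P n)) (L n) Polynomial.X

/-! ### Subsets -/

/-- The set `𝓘_k` of `k`-element subsets of `[n]`. -/
abbrev II (n k : ℕ) : Type := {I : Finset (Fin n) // I.card = k}

/-- The increasing enumeration `i_1 < … < i_k` of `I`. -/
def elt {n k : ℕ} (I : II n k) (r : Fin k) : Fin n := I.1.orderEmbOfFin I.2 r

/-- The complement of `I` in `[n]`. -/
def compl {n k : ℕ} (I : II n k) : II n (n - k) :=
  ⟨I.1ᶜ, by rw [Finset.card_compl, Fintype.card_fin, I.2]⟩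

/-- The subset `σ(I)`. -/
def act {n k : ℕ} (σ : Equiv.Perm (Fin n)) (I : II n k) : II n k :=
  ⟨I.1.map σ.toEmbedding, by rw [Finset.card_map, I.2]⟩

/-- `w(i, I) = - #{j > i, j ∉ I} + #{j > i, j ∈ I}`. -/
def w {n k : ℕ} (i : Fin n) (I : II n k) : ℤ :=
  -(((Finset.univ.filter fun j => i < j ∧ j ∉ I.1).card : ℕ) : ℤ) +
    (((Finset.univ.filter fun j => i < j ∧ j ∈ I.1).card : ℕ) : ℤ)

/-! ### Weight functions

The weight functions are rational expressions in `λ, t, z, y`. They are defined here as functions of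
values of these variables in an arbitrary commutative ring. Division is written with `Ring.inverse`;
it is only used at values for which the denominators are units (see the lemmas `isUnit_…`). -/

section Weight

variable {A : Type*} [CommRing A] {n k : ℕ}

/-- The factor `l_I(r, a)`. -/
def lFactor (I : II n k) (la : A) (t : Fin k → A) (zz : Fin n → A) (yy : A)
    (r : Fin k) (a : Fin n) : A :=
  if a < elt I r then t r - zz a + yy
  else if a = elt I r then la + t r - zz a - (w (elt I r) I : A) * yy
  else t r - zz a

/-- The expression which is symmetrized in the definition of the weight function. -/
def weightTerm (I : II n k) (la : A) (t : Fin k → A) (zz : Fin n → A) (yy : A) : A :=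
  (∏ r : Fin k, ∏ a : Fin n, lFactor I la t zz yy r a) *
    ∏ a : Fin k, ∏ b ∈ Finset.Ioi a, ((t a - t b + yy) * Ring.inverse (t a - t b))

/-- The weight function `W_I(λ, t, z, y)`. -/
def W (I : II n k) (la : A) (t : Fin k → A) (zz : Fin n → A) (yy : A) : A :=
  yy ^ k * ∑ σ : Equiv.Perm (Fin k), weightTerm I la (fun r => t (σ r)) zz yy

/-- The weight function `W_{σ,I}(λ, t, z, y) = W_{σ⁻¹(I)}(λ, t, z_{σ(1)}, …, z_{σ(n)}, y)`. -/
def Wσ (σ : Equiv.Perm (Fin n)) (I : II n k) (la : A) (t : Fin k → A) (zz : Fin n → A)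
    (yy : A) : A :=
  W (act σ⁻¹ I) la t (fun a => zz (σ a)) yy

/-- `e_k(t, y) = ∏_{a,b} (t_a - t_b + y)`. -/
def e (t : Fin k → A) (yy : A) : A := ∏ a : Fin k, ∏ b : Fin k, (t a - t b + yy)

/-- `C^{(r)}_{σ,I} = ∏_{i ∈ I} (λ - (w(σ⁻¹(i), σ⁻¹(I)) + r) y)`. -/
def Cσ (r : ℤ) (σ : Equiv.Perm (Fin n)) (I : II n k) (la yy : A) : A :=
  ∏ i ∈ I.1, (la - ((w (σ⁻¹ i) (act σ⁻¹ I) + r : ℤ) : A) * yy)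

/-- `W̃⁺_{σ,I} = W_{σ,I} / (C⁽⁰⁾_{σ,I} C⁽¹⁾_{σ,I} e_k)`. -/
def Wplus (σ : Equiv.Perm (Fin n)) (I : II n k) (la : A) (t : Fin k → A) (zz : Fin n → A)
    (yy : A) : A :=
  Wσ σ I la t zz yy * Ring.inverse (Cσ 0 σ I la yy * Cσ 1 σ I la yy * e t yy)

/-- `W̃⁻_I = (-1)^k W_{s₀,I}(-λ - (n - 2k) y, t, z, y) / e_k`, where `s₀` is the longest
permutation. -/
def Wminus (I : II n k) (la : A) (t : Fin k → A) (zz : Fin n → A) (yy : A) : A :=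
  (-1) ^ k * Wσ Fin.revPerm I (-la - (((n : ℤ) - 2 * (k : ℤ) : ℤ) : A) * yy) t zz yy *
    Ring.inverse (e t yy)

end Weight

/-- The substitution `z_I` of the variables `t_1, …, t_k`. -/
def zAt {n k : ℕ} (I : II n k) (r : Fin k) : L n := z (elt I r)

/-- `R_I(z) = ∏_{a ∈ I} ∏_{b ∉ I} (z_a - z_b)`. -/
def R {n k : ℕ} (I : II n k) : L n := ∏ a ∈ I.1, ∏ b ∈ I.1ᶜ, (z a - z b)

/-- `Q_I(z, y) = ∏_{a ∈ I} ∏_{b ∉ I} (z_a - z_b + y)`. -/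
def Q {n k : ℕ} (I : II n k) : L n := ∏ a ∈ I.1, ∏ b ∈ I.1ᶜ, (z a - z b + y n)

/-! All denominators that occur are units of `𝓛_{λ,z,y}`. -/

lemma isUnit_of_mem {n : ℕ} {p : Polynomial (P n)} (hp : p ∈ denominators n) :
    IsUnit (algebraMap (Polynomial (P n)) (L n) p) :=
  IsLocalization.map_units (L n) (⟨p, hp⟩ : denominators n)

lemma algebraMap_C {n : ℕ} (p : P n) :
    algebraMap (Polynomial (P n)) (L n) (Polynomial.C p) = algebraMap (P n) (L n) p :=
  (IsScalarTower.algebraMap_apply (P n) (Polynomial (P n)) (L n) p).symm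

lemma isUnit_sub {n : ℕ} {i j : Fin n} (h : i ≠ j) : IsUnit (z i - z j : L n) := by
  have := isUnit_of_mem (n := n) (p := Polynomial.C (zP i - zP j))
    (Submonoid.subset_closure (Or.inl (Or.inl ⟨i, j, h, rfl⟩)))
  rwa [algebraMap_C, map_sub] at this

lemma isUnit_sub_add {n : ℕ} (i j : Fin n) : IsUnit (z i - z j + y n : L n) := by
  have := isUnit_of_mem (n := n) (p := Polynomial.C (zP j - zP i - yP n))
    (Submonoid.subset_closure (Or.inl (Or.inr ⟨j, i, rfl⟩)))
  rw [algebraMap_C, map_sub, map_sub] at this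
  have h2 := this.neg
  have : -(z j - z i - y n : L n) = z i - z j + y n := by ring
  rw [← this]
  exact h2

lemma isUnit_lam {n : ℕ} (l : ℤ) : IsUnit (lam n - (l : L n) * y n) := by
  have := isUnit_of_mem (n := n) (p := Polynomial.X + Polynomial.C (((-l : ℤ) : P n) * yP n))
    (Submonoid.subset_closure (Or.inr ⟨-l, rfl⟩))
  rw [map_add, algebraMap_C, map_mul, map_intCast] at this
  have h2 : (lam n - (l : L n) * y n) = lam n + ((-l : ℤ) : L n) * y n := by push_cast; ring
  rw [h2]
  exact this

lemma isUnit_zAt_sub {n k : ℕ} (I : II n k) {a b : Fin k} (h : a ≠ b) :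
    IsUnit (zAt I a - zAt I b) :=
  isUnit_sub fun hab => h ((I.1.orderEmbOfFin I.2).injective hab)

lemma isUnit_e {n k : ℕ} (I : II n k) : IsUnit (e (zAt I) (y n)) := by
  simp only [e, IsUnit.prod_univ_iff]
  exact fun a b => isUnit_sub_add _ _

lemma isUnit_C {n k : ℕ} (r : ℤ) (σ : Equiv.Perm (Fin n)) (I : II n k) :
    IsUnit (Cσ r σ I (lam n) (y n)) := by
  simp only [Cσ, IsUnit.prod_iff]
  exact fun a _ => isUnit_lam _

lemma isUnit_R {n k : ℕ} (I : II n k) : IsUnit (R I) := by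
  simp only [R, IsUnit.prod_iff]
  refine fun a ha b hb => isUnit_sub ?_
  rintro rfl
  exact (Finset.mem_compl.1 hb) ha

lemma isUnit_Q {n k : ℕ} (I : II n k) : IsUnit (Q I) := by
  simp only [Q, IsUnit.prod_iff]
  exact fun a _ b _ => isUnit_sub_add _ _

/-! ### Equivariant cohomology of `T^*Gr_k(ℂⁿ)`, through its standard presentation -/

/-- The ring `ℂ[Γ, z, y] = ℂ[z, y][Γ]`, where `Sum.inl i` indexes `γ_{1,i}` and `Sum.inr j` indexes
`γ_{2,j}`. -/
abbrev PΓ (n k : ℕ) : Type := MvPolynomial (Fin k ⊕ Fin (n - k)) (P n)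

/-- The `ℂ[z, y]`-algebra `ℂ[Γ, z, y]^{S_k × S_{n-k}}`. -/
def invariants (n k : ℕ) : Subalgebra (P n) (PΓ n k) where
  carrier := {f | ∀ (s : Equiv.Perm (Fin k)) (t : Equiv.Perm (Fin (n - k))),
    MvPolynomial.rename (Sum.map s t) f = f}
  mul_mem' hf hg s t := by rw [map_mul, hf s t, hg s t]
  add_mem' hf hg s t := by rw [map_add, hf s t, hg s t]
  algebraMap_mem' r s t := AlgHom.commutes _ r

instance instCommRingInvariants (n k : ℕ) : CommRing (invariants n k) :=
  Subalgebra.toCommRing (invariants n k)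

/-- The polynomial `∏ (u - γ_{1,i}) ∏ (u - γ_{2,j}) - ∏ (u - z_a)` in `u`. -/
def relationPoly (n k : ℕ) : Polynomial (PΓ n k) :=
  (∏ i : Fin k, (Polynomial.X - Polynomial.C (MvPolynomial.X (Sum.inl i)))) *
      (∏ j : Fin (n - k), (Polynomial.X - Polynomial.C (MvPolynomial.X (Sum.inr j)))) -
    ∏ a : Fin n, (Polynomial.X - Polynomial.C (MvPolynomial.C (zP a)))

/-- The coefficient of `u ^ m` in the above polynomial, as an invariant. -/
def relation (n k m : ℕ) : invariants n k :=
  ⟨(relationPoly n k).coeff m, by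
    intro s t
    have h : (relationPoly n k).map
        (MvPolynomial.rename (R := P n) (Sum.map s t)).toRingHom = relationPoly n k := by
      simp only [relationPoly, Polynomial.map_sub, Polynomial.map_mul, Polynomial.map_prod,
        Polynomial.map_X, Polynomial.map_C, AlgHom.toRingHom_eq_coe, RingHom.coe_coe,
        MvPolynomial.rename_X, MvPolynomial.rename_C, Sum.map_inl, Sum.map_inr]
      rw [Equiv.prod_comp s fun i : Fin k => (Polynomial.X - Polynomial.C
          (MvPolynomial.X (Sum.inl i)) : Polynomial (PΓ n k)),
        Equiv.prod_comp t fun i : Fin (n - k) => (Polynomial.X - Polynomial.C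
          (MvPolynomial.X (Sum.inr i)) : Polynomial (PΓ n k))]
    conv_rhs => rw [← h]
    rw [Polynomial.coeff_map]
    rfl⟩

/-- `H^*_T(T^*Gr_k(ℂⁿ)) = ℂ[Γ, z, y]^{S_k × S_{n-k}} / (coefficients of the above polynomial)`. -/
def H (n k : ℕ) : Type :=
  invariants n k ⧸ Ideal.span (Set.range (relation n k))

instance instCommRingH (n k : ℕ) : CommRing (H n k) := Ideal.Quotient.commRing _

instance instAlgebraH (n k : ℕ) : Algebra (P n) (H n k) :=
  Ideal.Quotient.algebra (P n) (A := invariants n k)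

/-- `H^*_T(T^*Gr_k(ℂⁿ)) ⊗ 𝓛_{λ,z,y}`, the tensor product being over `ℂ[z, y]`. -/
abbrev HL (n k : ℕ) : Type := L n ⊗[P n] H n k

/-- `H^*_T(𝓧_n) ⊗ 𝓛_{λ,z,y} = ⨁_{k=0}^n H^*_T(T^*Gr_k(ℂⁿ)) ⊗ 𝓛_{λ,z,y}`, where `𝓧_n` is the
disjoint union of the `T^*Gr_k(ℂⁿ)`. -/
abbrev HXL (n : ℕ) : Type := (k : Fin (n + 1)) → HL n k

/-- The class `[f]` in `H^*_T(T^*Gr_k(ℂⁿ))` of an invariant polynomial `f`. -/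
def cls {n k : ℕ} (f : invariants n k) : H n k :=
  Ideal.Quotient.mk (Ideal.span (Set.range (relation n k))) f

/-- The inclusion of the summand `H^*_T(T^*Gr_k(ℂⁿ)) ⊗ 𝓛_{λ,z,y}` in
`H^*_T(𝓧_n) ⊗ 𝓛_{λ,z,y}`. -/
def incl {n : ℕ} (k : Fin (n + 1)) : HL n k →ₗ[L n] HXL n :=
  LinearMap.single (L n) (fun k : Fin (n + 1) => HL n k) k

/-- The substitution `f ↦ f(z_I, z, y)` on `ℂ[Γ, z, y]`: the `γ_{1,*}` go to the `z_a` with `a ∈ I`,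
the `γ_{2,*}` to the `z_a` with `a ∉ I`. -/
def subst {n k : ℕ} (I : II n k) : PΓ n k →ₐ[P n] P n :=
  MvPolynomial.aeval (Sum.elim (fun i => zP (elt I i)) fun j => zP (elt (compl I) j))

lemma prod_elt {n k : ℕ} (I : II n k) {A : Type*} [CommMonoid A] (f : Fin n → A) :
    ∏ i : Fin k, f (elt I i) = ∏ a ∈ I.1, f a := by
  rw [← Finset.map_orderEmbOfFin_univ I.1 I.2, Finset.prod_map]
  rfl

lemma subst_relation {n k : ℕ} (I : II n k) (m : ℕ) :
    subst I (relation n k m : PΓ n k) = 0 := by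
  have h : (relationPoly n k).map (subst I).toRingHom = 0 := by
    simp only [relationPoly, Polynomial.map_sub, Polynomial.map_mul, Polynomial.map_prod,
      Polynomial.map_X, Polynomial.map_C, AlgHom.toRingHom_eq_coe, RingHom.coe_coe, subst,
      MvPolynomial.aeval_X, MvPolynomial.aeval_C, Sum.elim_inl, Sum.elim_inr, Algebra.algebraMap_self,
      RingHom.id_apply]
    rw [prod_elt I fun a => (Polynomial.X - Polynomial.C (zP a) : Polynomial (P n)),
      prod_elt (compl I) fun a => (Polynomial.X - Polynomial.C (zP a) : Polynomial (P n))]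
    simp only [compl]
    rw [Finset.prod_mul_prod_compl, sub_self]
  have := congrArg (fun p => Polynomial.coeff p m) h
  simp only [Polynomial.coeff_map, Polynomial.coeff_zero] at this
  exact this

/-- The localization component `Loc_I : H^*_T(T^*Gr_k(ℂⁿ)) → ℂ[z, y]`, `[f] ↦ f(z_I, z, y)`. -/
def loc {n k : ℕ} (I : II n k) : H n k →ₐ[P n] P n :=
  Ideal.Quotient.liftₐ _ ((subst I).comp (invariants n k).val) (by
    intro a ha
    have hle : Ideal.span (Set.range (relation n k)) ≤
        RingHom.ker ((subst I).comp (invariants n k).val) := by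
      rw [Ideal.span_le]
      rintro _ ⟨m, rfl⟩
      exact subst_relation I m
    exact hle ha)

/-- The restriction `[f] ↦ f(λ, z_I, z, y)` to the fixed point `x_I`, after extension of
coefficients. -/
def restr {n k : ℕ} (I : II n k) : HL n k →ₐ[L n] L n :=
  Algebra.TensorProduct.lift (AlgHom.id (L n) (L n)) ((Algebra.ofId (P n) (L n)).comp (loc I))
    fun _ _ => Commute.all _ _

/-- The invariant polynomial `∏_{i=1}^k ∏_{j ∉ I} (γ_{1,i} - z_j)`. -/
def fixedPoly {n k : ℕ} (I : II n k) : invariants n k :=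
  ⟨∏ i : Fin k, ∏ j ∈ I.1ᶜ, (MvPolynomial.X (Sum.inl i) - MvPolynomial.C (zP j)), by
    intro s t
    simp only [map_prod, map_sub, MvPolynomial.rename_X, MvPolynomial.rename_C, Sum.map_inl]
    exact Equiv.prod_comp s fun i : Fin k => ∏ j ∈ I.1ᶜ,
      (MvPolynomial.X (Sum.inl i) - MvPolynomial.C (zP j) : PΓ n k)⟩

lemma restr_tmul {n k : ℕ} (I : II n k) (c : L n) (f : invariants n k) :
    restr I (c ⊗ₜ cls f) = c * algebraMap (P n) (L n) (subst I (f : PΓ n k)) := rfl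

lemma subst_fixedPoly {n k : ℕ} (I J : II n k) :
    algebraMap (P n) (L n) (subst I (fixedPoly J : PΓ n k)) = if J = I then R J else 0 := by
  have h : algebraMap (P n) (L n) (subst I (fixedPoly J : PΓ n k)) =
      ∏ a ∈ I.1, ∏ b ∈ J.1ᶜ, (z a - z b) := by
    rw [← prod_elt I fun a => ∏ b ∈ J.1ᶜ, (z a - z b)]
    simp [fixedPoly, subst, z]
  rw [h]
  split_ifs with hJI
  · subst hJI; rfl
  · obtain ⟨a, haI, haJ⟩ : ∃ a ∈ I.1, a ∉ J.1 := by
      by_contra! hc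
      exact hJI (Subtype.ext (Finset.eq_of_subset_of_card_le hc (by rw [I.2, J.2])).symm)
    exact Finset.prod_eq_zero haI
      (Finset.prod_eq_zero (Finset.mem_compl.2 haJ) (sub_self _))

/-- Classes with arbitrary prescribed restrictions to the fixed points exist over
`𝓛_{λ,z,y}`. -/
lemma exists_restr {n k : ℕ} (g : II n k → L n) : ∃ κ : HL n k, ∀ J, restr J κ = g J := by
  refine ⟨∑ I : II n k, (g I * Ring.inverse (R I)) ⊗ₜ cls (fixedPoly I), fun J => ?_⟩
  simp only [map_sum, restr_tmul, subst_fixedPoly, mul_ite, mul_zero, Finset.sum_ite_eq',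
    Finset.mem_univ, if_true]
  rw [mul_assoc, Ring.inverse_mul_cancel _ (isUnit_R J), mul_one]

/-! ### The space `(ℂ²)^{⊗n} ⊗ 𝓛_{λ,z,y}` -/

/-- `(ℂ²)^{⊗n} ⊗ 𝓛_{λ,z,y} = H^*_T((𝓧_n)^T) ⊗ 𝓛_{λ,z,y}`. -/
abbrev V (n : ℕ) : Type := L n ⊗[ℂ] (⨂[ℂ] _ : Fin n, (Fin 2 → ℂ))

/-- The vector `v_I = v_{i_1} ⊗ … ⊗ v_{i_n}`, `i_j = 1` for `j ∈ I` and `i_j = 2` for `j ∉ I`. Here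
the standard basis `v_1, v_2` of `ℂ²` is indexed by `0, 1 : Fin 2`. -/
def v {n : ℕ} (I : Finset (Fin n)) : V n :=
  1 ⊗ₜ PiTensorProduct.tprod ℂ fun j => Pi.single (if j ∈ I then (0 : Fin 2) else 1) (1 : ℂ)

/-- Subsets of `[n]` as functions `[n] → {1, 2}`. -/
def indexEquiv (n : ℕ) : (Fin n → Fin 2) ≃ Finset (Fin n) where
  toFun p := Finset.univ.filter fun j => p j = 0
  invFun I j := if j ∈ I then 0 else 1
  left_inv p := by
    funext j
    by_cases h : p j = 0
    · simp [h]
    · simp only [Finset.mem_filter, Finset.mem_univ, true_and, h, if_false]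
      omega
  right_inv I := by
    ext j
    by_cases h : j ∈ I <;> simp [h]

/-- The vectors `v_I` as a basis of `(ℂ²)^{⊗n} ⊗ 𝓛_{λ,z,y}`. -/
def vBasis (n : ℕ) : Module.Basis (Finset (Fin n)) (L n) (V n) :=
  ((Basis.piTensorProduct fun _ : Fin n => Pi.basisFun ℂ (Fin 2)).baseChange (L n)).reindex
    (indexEquiv n)

lemma vBasis_apply {n : ℕ} (I : Finset (Fin n)) : vBasis n I = v I := by
  simp [vBasis, v, indexEquiv]

/-! ### Stable envelopes and the map `ν` -/

/-- The class `κ_{σ,I}`, with `κ_{σ,I}|_{x_J} = W̃⁺_{σ,I}(λ, z_J, z, y)` for all `J`. -/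
def kappa {n k : ℕ} (σ : Equiv.Perm (Fin n)) (I : II n k) : HL n k :=
  (exists_restr fun J : II n k => Wplus σ I (lam n) (zAt J) z (y n)).choose

lemma restr_kappa {n k : ℕ} (σ : Equiv.Perm (Fin n)) (I J : II n k) :
    restr J (kappa σ I) = Wplus σ I (lam n) (zAt J) z (y n) :=
  (exists_restr fun J : II n k => Wplus σ I (lam n) (zAt J) z (y n)).choose_spec J

/-- The number of elements of a subset of `[n]`, as an element of `{0, …, n}`. -/
def size {n : ℕ} (I : Finset (Fin n)) : Fin (n + 1) :=
  ⟨I.card, Nat.lt_succ_of_le (by simpa using I.card_le_univ)⟩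

/-- The dynamical stable envelope map `Stab_σ`, the `𝓛_{λ,z,y}`-linear map with
`v_I ↦ κ_{σ,I}`. -/
def Stab {n : ℕ} (σ : Equiv.Perm (Fin n)) : V n →ₗ[L n] HXL n :=
  (vBasis n).constr ℕ fun I => incl (size I) (kappa σ ⟨I, rfl⟩)

lemma Stab_v {n : ℕ} (σ : Equiv.Perm (Fin n)) {k : Fin (n + 1)} (I : II n k) :
    Stab σ (v I.1) = incl k (kappa σ I) := by
  obtain ⟨I, hI⟩ := I
  obtain rfl : size I = k := Fin.ext hI
  rw [← vBasis_apply, Stab, Module.Basis.constr_basis]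

/-- `ξ_I = Q_I(z, y)⁻¹ ∑_{J ∈ 𝓘_k} W̃⁻_J(λ, z_I, z, y) v_J`. -/
def xi {n k : ℕ} (I : II n k) : V n :=
  Ring.inverse (Q I) • ∑ J : II n k, Wminus J (lam n) (zAt I) z (y n) • v J.1

/-- The `𝓛_{λ,z,y}`-linear map `ν`, which sends a class `[f]` on `T^*Gr_k(ℂⁿ)` to
`∑_{I ∈ 𝓘_k} f(λ, z_I, z, y) / R_I(z) ξ_I`. -/
def nu (n : ℕ) : HXL n →ₗ[L n] V n :=
  ∑ k : Fin (n + 1), ∑ I : II n k,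
    (((restr I).toLinearMap ∘ₗ LinearMap.proj k).smulRight (Ring.inverse (R I) • xi I))

end DynStab

end

/-!
The identity `ν ∘ Stab = id` is the orthogonality relation
`∑_K W̃⁺_I(z_K) W̃⁻_J(z_K) / (R_K Q_K) = δ_{IJ}`, which may be checked in the field of fractions of
`𝓛`. Splitting the symmetrization according to the variable assigned to the first position
expresses the weight functions of `z_1, …, z_n` through those of `z_2, …, z_n`, so one can induct
on `n`. The sum reduces to the sum for `n - 1` points times a scalar when `1` belongs to both or to
neither of `I` and `J`, and vanishes termwise when `1 ∈ I \ J`. When `1 ∈ J \ I`, fix all variables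
but one, say `s`: the remaining sum over `s` is a sum of residues of `p(s) / ∏_a (s - a)`, and it
vanishes by the residue theorem because the two top coefficients of `p` leave no residue at
infinity. The choice of the dynamical shifts `w(i, I)` is exactly what makes these coefficients
match.

The orthogonality relation says that two square matrices are inverse to each other on one side,
hence on both sides. It remains to see that a class is determined by its restrictions to the fixed
points. The relation says that `A(u) B(u) = ∏_a (u - z_a)`, where `A` and `B` are the Chern
polynomials of the tautological and the quotient bundle. As the differences `z_a - z_b` are units,
polynomials of small degree are determined by their values at the `z_a`; it follows that
multiplying any class `f` by `π_I = ∏_{a ∉ I} A(z_a)` gives `f|_{x_I} π_I`, and that a class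
annihilated by all the `π_I` is zero.
-/

noncomputable section

namespace DynStab

section Residues

open Polynomial Finset

/-- `p` has the form `A (X ^ d + c X ^ (d - 1))` plus terms of degree at most `d - 2`. The two top
coefficients are read off from the reversed polynomial; for `d = 0` the condition is that `p` is
constant, and equal to `0` unless `c` annihilates it. -/
def HasTopRatio {R : Type*} [CommSemiring R] (d : ℕ) (c : R) (p : R[X]) : Prop :=
  p.natDegree ≤ d ∧ (p.reflect d).coeff 1 = c * (p.reflect d).coeff 0

lemma prod_sub_ne_zero {R : Type*} [CommRing R] [IsDomain R] {K : Finset R} {s : R} (hs : s ∉ K) :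
    ∏ b ∈ K, (s - b) ≠ 0 :=
  Finset.prod_ne_zero_iff.2 fun _ hb => sub_ne_zero.2 (ne_of_mem_of_not_mem hb hs).symm

lemma prod_sub_left_ne_zero {R : Type*} [CommRing R] [IsDomain R] {K : Finset R} {s : R}
    (hs : s ∉ K) : ∏ b ∈ K, (b - s) ≠ 0 :=
  Finset.prod_ne_zero_iff.2 fun _ hb => sub_ne_zero.2 (ne_of_mem_of_not_mem hb hs)

namespace HasTopRatio

section CommSemiring

variable {R : Type*} [CommSemiring R] {d d' : ℕ} {c c' : R} {p q : R[X]}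

lemma add (hp : HasTopRatio d c p) (hq : HasTopRatio d c q) : HasTopRatio d c (p + q) := by
  refine ⟨natDegree_add_le_of_degree_le hp.1 hq.1, ?_⟩
  rw [reflect_add, coeff_add, coeff_add, hp.2, hq.2, mul_add]

lemma sum {ι : Type*} {s : Finset ι} {f : ι → R[X]} (hf : ∀ i ∈ s, HasTopRatio d c (f i)) :
    HasTopRatio d c (∑ i ∈ s, f i) :=
  Finset.sum_induction f _ (fun _ _ => add) (by simp [HasTopRatio]) hf

lemma mul (hp : HasTopRatio d c p) (hq : HasTopRatio d' c' q) :
    HasTopRatio (d + d') (c + c') (p * q) := by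
  refine ⟨natDegree_mul_le_of_le hp.1 hq.1, ?_⟩
  rw [reflect_mul _ _ hp.1 hq.1, mul_coeff_one, mul_coeff_zero, hp.2, hq.2]
  ring

lemma const (a : R) : HasTopRatio 0 0 (C a) := by
  simp [HasTopRatio]

lemma C_mul (a : R) (hp : HasTopRatio d c p) : HasTopRatio d c (C a * p) := by
  simpa using (HasTopRatio.const a).mul hp

lemma X_add_C (a : R) : HasTopRatio 1 a (X + C a) :=
  ⟨natDegree_add_C.le.trans natDegree_X_le, by simp [coeff_X, coeff_C, coeff_one]⟩

lemma list_prod_X_add_C (l : List R) :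
    HasTopRatio l.length l.sum (l.map fun a => X + C a).prod := by
  induction l with
  | nil => simpa using HasTopRatio.const (1 : R)
  | cons a l ih =>
    rw [List.length_cons, List.map_cons, List.sum_cons, List.prod_cons, add_comm l.length]
    exact (X_add_C a).mul ih

lemma prod_X_add_C {ι : Type*} (s : Finset ι) (f : ι → R) :
    HasTopRatio #s (∑ i ∈ s, f i) (∏ i ∈ s, (X + C (f i))) := by
  simpa [Function.comp_def] using list_prod_X_add_C (s.toList.map f)

end CommSemiring

section CommRing

variable {R : Type*} [CommRing R] {d : ℕ} {c : R} {p q : R[X]}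

lemma prod_X_sub_C (s : Finset R) :
    HasTopRatio #s (-∑ b ∈ s, b) (∏ b ∈ s, (X - C b)) := by
  rw [← Finset.sum_neg_distrib]
  simpa [sub_eq_add_neg] using prod_X_add_C s (-·)

lemma list_prod_X_sub_C (l : List R) :
    HasTopRatio l.length (-l.sum) (l.map fun b => X - C b).prod := by
  simpa [List.sum_neg, Function.comp_def, ← sub_eq_add_neg] using list_prod_X_add_C (l.map (-·))

lemma of_monic_mul (hpm : p.Monic) (hp : HasTopRatio p.natDegree c p) {c' : R}
    (hpq : HasTopRatio (p.natDegree + d) (c + c') (p * q)) : HasTopRatio d c' q := by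
  have hq : q.natDegree ≤ d := by
    rcases eq_or_ne q 0 with rfl | hq0
    · simp
    · have := hpq.1
      rw [hpm.natDegree_mul' hq0] at this
      omega
  have hp0 : (p.reflect p.natDegree).coeff 0 = 1 := by simp [coeff_reflect, revAt_le, hpm]
  have h := hpq.2
  rw [reflect_mul _ _ le_rfl hq, mul_coeff_one, mul_coeff_zero, hp.2, hp0] at h
  exact ⟨hq, by linear_combination h⟩

end CommRing

variable {F : Type*} [Field F] {d : ℕ} {c : F}

lemma exists_eval_eq_div {q : F[X]} {K : Finset F}
    (hq : HasTopRatio (d + #K) (c - ∑ b ∈ K, b) q) (hK : ∀ b ∈ K, q.eval b = 0) :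
    ∃ p : F[X], HasTopRatio d c p ∧ ∀ s ∉ K, p.eval s = q.eval s / ∏ b ∈ K, (s - b) := by
  obtain ⟨p, rfl⟩ : ∏ b ∈ K, (X - C b) ∣ q :=
    Finset.prod_dvd_of_coprime
      (fun a _ b _ hab => isCoprime_X_sub_C_of_isUnit_sub (sub_ne_zero.2 hab).isUnit)
      fun b hb => dvd_iff_isRoot.2 (hK b hb)
  have hmonic : (∏ b ∈ K, (X - C b)).Monic := monic_prod_X_sub_C _ K
  have hdeg : (∏ b ∈ K, (X - C b)).natDegree = #K :=
    natDegree_finsetProd_X_sub_C_eq_card K id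
  refine ⟨p, of_monic_mul hmonic (c := -∑ b ∈ K, b) ?_ ?_, fun s hs => ?_⟩
  · rw [hdeg]
    exact prod_X_sub_C K
  · rw [hdeg]
    rwa [add_comm #K, neg_add_eq_sub]
  · rw [eval_mul, eval_prod]
    simp [prod_sub_ne_zero hs]

lemma sum_eval_div_eq_zero [DecidableEq F] {N : Finset F} {p : F[X]}
    (hp : HasTopRatio #N (-∑ s ∈ N, s) p) :
    ∑ s ∈ N, p.eval s / ∏ b ∈ N.erase s, (s - b) = 0 := by
  rcases N.eq_empty_or_nonempty with rfl | hN
  · simp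
  set A : F[X] := ∏ s ∈ N, (X - C s)
  set q : F[X] := p + C (-p.coeff #N) * A
  have hA : A.coeff #N = 1 := by
    have hmonic : A.Monic := monic_prod_X_sub_C _ N
    rw [← natDegree_finsetProd_X_sub_C_eq_card N id]
    exact hmonic
  have hq : HasTopRatio #N (-∑ s ∈ N, s) q := hp.add ((prod_X_sub_C N).C_mul _)
  have hq0 : q.coeff #N = 0 := by simp [q, hA]
  have hq1 : q.coeff (#N - 1) = 0 := by
    have h := hq.2
    rwa [coeff_reflect, coeff_reflect, revAt_le hN.card_pos, revAt_le (Nat.zero_le _), Nat.sub_zero,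
      hq0, mul_zero] at h
  have hdeg : q.degree < #N := by
    refine (degree_lt_iff_coeff_zero _ _).2 fun m hm => ?_
    rcases hm.eq_or_lt with rfl | hm
    · exact hq0
    · exact coeff_eq_zero_of_natDegree_lt (hq.1.trans_lt hm)
  have heval : ∀ s ∈ N, q.eval s = p.eval s := fun s hs => by
    simp [q, A, eval_prod, Finset.prod_eq_zero hs (sub_self s)]
  have := Lagrange.coeff_eq_sum (s := N) (v := id) Function.injective_id.injOn hdeg
  rw [hq1] at this
  rw [this]
  exact Finset.sum_congr rfl fun s hs => by rw [id, heval s hs]; rfl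

lemma sum_sdiff_eval_div_eq_zero [DecidableEq F] {Z K : Finset F} {y : F} {p : F[X]} (hK : K ⊆ Z)
    (hy : ∀ a ∈ Z, ∀ b ∈ K, a - b + y ≠ 0) (hp : HasTopRatio #Z (#K * y - ∑ s ∈ Z, s) p)
    (hpK : ∀ b ∈ K, p.eval (b - y) = 0) :
    ∑ s ∈ Z \ K, p.eval s / ((∏ b ∈ (Z \ K).erase s, (s - b)) * ∏ b ∈ K, (s - b + y)) = 0 := by
  set K' : Finset F := K.image (· - y)
  have hinj : Function.Injective fun b : F => b - y := sub_left_injective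
  have hdisj : Disjoint (Z \ K) K' := by
    rw [Finset.disjoint_left]
    intro a ha ha'
    obtain ⟨b, hb, rfl⟩ := Finset.mem_image.1 ha'
    exact hy _ (Finset.sdiff_subset ha) b hb (by ring)
  have hcard : #((Z \ K) ∪ K') = #Z := by
    rw [Finset.card_union_of_disjoint hdisj, Finset.card_image_of_injective _ hinj,
      Finset.card_sdiff_add_card_eq_card hK]
  have hsum : -∑ s ∈ (Z \ K) ∪ K', s = #K * y - ∑ s ∈ Z, s := by
    rw [Finset.sum_union hdisj, Finset.sum_image hinj.injOn, Finset.sum_sub_distrib,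
      Finset.sum_const, nsmul_eq_mul, ← Finset.sum_sdiff hK]
    ring
  rw [← hcard, ← hsum] at hp
  have hres := hp.sum_eval_div_eq_zero
  rw [Finset.sum_union hdisj, Finset.sum_image hinj.injOn, Finset.sum_eq_zero (s := K)
    fun b hb => by rw [hpK b hb, zero_div], add_zero] at hres
  rw [← hres]
  refine Finset.sum_congr rfl fun s hs => ?_
  have hs' : s ∉ K' := Finset.disjoint_left.1 hdisj hs
  rw [Finset.erase_union_distrib, Finset.erase_eq_of_notMem hs',
    Finset.prod_union (Finset.disjoint_of_subset_left (Finset.erase_subset _ _) hdisj),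
    Finset.prod_image hinj.injOn]
  simp only [sub_sub_eq_add_sub, sub_add_eq_add_sub]

lemma mul_prod_erase_sub_div_prod_sub [DecidableEq F] {K : Finset F} {κ s : F} (hκ : κ ∈ K)
    (hs : s ∉ K) (y : F) :
    (s - κ - y) * (∏ b ∈ K.erase κ, (s - b)) / ∏ b ∈ K, (s - b) = (κ - s + y) / (κ - s) := by
  have herase := prod_sub_ne_zero fun h => hs (Finset.mem_of_mem_erase (a := κ) h)
  rw [← Finset.mul_prod_erase K _ hκ, mul_div_mul_right _ _ herase, ← neg_div_neg_eq, neg_sub,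
    neg_sub, sub_sub_eq_add_sub, sub_add_eq_add_sub, add_comm y]

/-- The values of the `v κ` make the residues of the right hand side at `κ ∈ K` cancel. -/
lemma exists_eval_eq_add_sum [DecidableEq F] {u : F[X]} {v : F → F[X]} {K : Finset F} {y : F}
    (hu : HasTopRatio d c u) (hv : ∀ κ ∈ K, HasTopRatio d (c + (#K + 1) * y) (v κ))
    (huv : ∀ κ ∈ K, (v κ).eval κ = u.eval κ * ∏ b ∈ K.erase κ, ((κ - b + y) / (κ - b))) :
    ∃ p : F[X], HasTopRatio d (c + #K * y) p ∧ ∀ s ∉ K, p.eval s =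
      u.eval s * ∏ b ∈ K, ((s - b + y) / (s - b)) +
        ∑ κ ∈ K, (κ - s + y) / (κ - s) * (v κ).eval s := by
  set q : F[X] := u * ∏ b ∈ K, (X + C (y - b)) +
    ∑ κ ∈ K, v κ * ((X + C (-κ - y)) * ∏ b ∈ K.erase κ, (X + C (-b))) with hq
  have hqeval (s : F) : q.eval s = u.eval s * ∏ b ∈ K, (s - b + y) +
      ∑ κ ∈ K, (v κ).eval s * ((s - κ - y) * ∏ b ∈ K.erase κ, (s - b)) := by
    simp [hq, eval_finsetSum, eval_prod, sub_eq_add_neg, add_assoc, add_comm y]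
  have hqtop : HasTopRatio (d + #K) (c + #K * y - ∑ b ∈ K, b) q := by
    refine add ?_ (sum fun κ hκ => ?_)
    · convert hu.mul (prod_X_add_C K fun b => y - b) using 1
      rw [Finset.sum_sub_distrib, Finset.sum_const, nsmul_eq_mul]
      ring
    · convert (hv κ hκ).mul ((X_add_C (-κ - y)).mul (prod_X_add_C (K.erase κ) (-·))) using 1
      · rw [add_comm 1, Finset.card_erase_add_one hκ]
      · rw [← Finset.add_sum_erase K _ hκ, Finset.sum_neg_distrib]
        ring
  have hqK : ∀ b ∈ K, q.eval b = 0 := by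
    intro b hb
    rw [hqeval, Finset.sum_eq_single_of_mem b hb, huv b hb, Finset.prod_div_distrib,
      ← Finset.mul_prod_erase K _ hb]
    · have hb_sub := prod_sub_ne_zero (Finset.notMem_erase b K)
      field_simp
      ring
    · intro κ _ hκ
      rw [Finset.prod_eq_zero (Finset.mem_erase.2 ⟨hκ.symm, hb⟩) (sub_self b), mul_zero, mul_zero]
  obtain ⟨p, hp, hpeval⟩ := exists_eval_eq_div hqtop hqK
  refine ⟨p, hp, fun s hs => ?_⟩
  rw [hpeval s hs, hqeval, add_div, mul_div_assoc, Finset.prod_div_distrib, Finset.sum_div]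
  congr 1
  exact Finset.sum_congr rfl fun κ hκ => by
    rw [mul_div_assoc, mul_prod_erase_sub_div_prod_sub hκ hs, mul_comm]

end HasTopRatio

end Residues

section Recursion

open Polynomial Finset

/-- The number of entries of `l` in `I` minus the number of entries of `l` not in `I`. If `l` lists
the elements after `i` in increasing order, then this is the number `w(i, I)`. -/
def listWeight {ι : Type*} [DecidableEq ι] (I : Finset ι) (l : List ι) : ℤ :=
  2 * (l.countP (· ∈ I) : ℤ) - l.length

lemma listWeight_congr {ι : Type*} [DecidableEq ι] {I J : Finset ι} {l : List ι}
    (h : ∀ a ∈ l, (a ∈ I ↔ a ∈ J)) : listWeight I l = listWeight J l := by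
  rw [listWeight, listWeight, List.countP_congr]
  simpa using h

/-- A symmetrized product over the assignments of the elements of `T` to the entries of `l` in `I`,
computed by removing the entries of `l` one by one. An element `s` assigned to the entry `a`
contributes `β w s a`, with `w` the weight of the tail after `a`, and a factor `α s b` or `γ s b`
for each entry `b` before or after `a`; two elements `s` and `t`, with `s` assigned to the earlier
entry, contribute the factor `g s t`. -/
def shuffleSum {ι X S : Type*} [DecidableEq ι] [DecidableEq X] [CommSemiring S]
    (α γ : X → ι → S) (g : X → X → S) (β : ℤ → X → ι → S) (I : Finset ι) :
    List ι → Finset X → S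
  | [], T => if T = ∅ then 1 else 0
  | a :: l, T =>
    if a ∈ I then
      ∑ s ∈ T, β (listWeight I l) s a * (l.map (γ s)).prod * (∏ b ∈ T.erase s, g s b * α b a) *
        shuffleSum α γ g β I l (T.erase s)
    else (∏ t ∈ T, α t a) * shuffleSum α γ g β I l T

lemma shuffleSum_eq_zero {ι X S : Type*} [DecidableEq ι] [DecidableEq X] [CommSemiring S]
    (α γ : X → ι → S) (g : X → X → S) (β : ℤ → X → ι → S) (I : Finset ι) (l : List ι) :
    ∀ T : Finset X, #T ≠ l.countP (· ∈ I) → shuffleSum α γ g β I l T = 0 := by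
  induction l with
  | nil =>
    intro T hT
    exact if_neg (by rintro rfl; simp at hT)
  | cons a l ih =>
    intro T hT
    rw [shuffleSum]
    split_ifs with ha
    · refine Finset.sum_eq_zero fun s hs => ?_
      rw [ih, mul_zero]
      rw [List.countP_cons_of_pos (by simpa using ha)] at hT
      have := Finset.card_erase_add_one hs
      omega
    · rw [ih, mul_zero]
      rwa [List.countP_cons_of_neg (by simpa using ha)] at hT

variable {F : Type*} [Field F] [DecidableEq F]

/-- The weight function `W_I(λ, t, z, y)`, for values in a field: `l` is the list of the `z_a`, `I`
is the set of the `z_i`, `i ∈ I`, and `T` is the set of the `t_r`. -/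
def listWplus (la yy : F) (I : Finset F) : List F → Finset F → F :=
  shuffleSum (fun t a => t - a + yy) (fun t a => t - a) (fun s b => (s - b + yy) / (s - b))
    (fun w s a => yy * (la + s - a - w * yy)) I

/-- The numerator of `W̃⁻_I`, in the same notation as in `listWplus`. -/
def listWminus (la yy : F) (I : Finset F) : List F → Finset F → F :=
  shuffleSum (fun t a => t - a) (fun t a => t - a + yy) (fun s b => (b - s + yy) / (b - s))
    (fun w s a => yy * (la + a - s - (w + 1) * yy)) I

variable {la yy : F} {I : Finset F} {x : F}

lemma listWplus_cons_of_mem (hx : x ∈ I) (l : List F) (T : Finset F) :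
    listWplus la yy I (x :: l) T = ∑ s ∈ T, yy * (la + s - x - listWeight I l * yy) *
      (l.map (s - ·)).prod * (∏ b ∈ T.erase s, (s - b + yy) / (s - b) * (b - x + yy)) *
        listWplus la yy I l (T.erase s) :=
  if_pos hx

lemma listWplus_cons_of_notMem (hx : x ∉ I) (l : List F) (T : Finset F) :
    listWplus la yy I (x :: l) T = (∏ t ∈ T, (t - x + yy)) * listWplus la yy I l T :=
  if_neg hx

lemma listWminus_cons_of_mem (hx : x ∈ I) (l : List F) (T : Finset F) :
    listWminus la yy I (x :: l) T = ∑ s ∈ T, yy * (la + x - s - (listWeight I l + 1) * yy) *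
      (l.map (s - · + yy)).prod * (∏ b ∈ T.erase s, (b - s + yy) / (b - s) * (b - x)) *
        listWminus la yy I l (T.erase s) :=
  if_pos hx

lemma listWminus_cons_of_notMem (hx : x ∉ I) (l : List F) (T : Finset F) :
    listWminus la yy I (x :: l) T = (∏ t ∈ T, (t - x)) * listWminus la yy I l T :=
  if_neg hx

lemma listWplus_eq_zero {l : List F} {T : Finset F} (h : #T ≠ l.countP (· ∈ I)) :
    listWplus la yy I l T = 0 :=
  shuffleSum_eq_zero _ _ _ _ _ _ _ h

lemma listWminus_eq_zero {l : List F} {T : Finset F} (h : #T ≠ l.countP (· ∈ I)) :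
    listWminus la yy I l T = 0 :=
  shuffleSum_eq_zero _ _ _ _ _ _ _ h

lemma listWplus_eq_zero_of_sub_mem (hy : yy ≠ 0) {b : F} {l : List F} (hb : b ∈ l) :
    ∀ {T : Finset F}, b ∈ T → b - yy ∈ T → listWplus la yy I l T = 0 := by
  have hne : b - yy ≠ b := by simpa using hy
  induction l with
  | nil => simp at hb
  | cons a l ih =>
    intro T hT hT'
    by_cases ha : a ∈ I
    · rw [listWplus_cons_of_mem ha]
      refine Finset.sum_eq_zero fun s _ => ?_
      by_cases hs : s = b - yy
      · rw [Finset.prod_eq_zero (i := b) (by simp [hT, hs, hne.symm]) (by simp [hs])]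
        ring
      by_cases hba : b = a
      · rw [Finset.prod_eq_zero (i := b - yy) (by simp [hT', Ne.symm hs]) (by simp [hba])]
        ring
      have hbl : b ∈ l := List.mem_of_ne_of_mem hba hb
      by_cases hsb : s = b
      · rw [List.prod_eq_zero (l := l.map _) (List.mem_map.2 ⟨b, hbl, by simp [hsb]⟩)]
        ring
      · rw [ih hbl (by simp [hT, Ne.symm hsb]) (by simp [hT', Ne.symm hs]), mul_zero]
    · rw [listWplus_cons_of_notMem ha]
      by_cases hba : b = a
      · rw [Finset.prod_eq_zero hT' (by simp [hba]), zero_mul]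
      · rw [ih (List.mem_of_ne_of_mem hba hb) hT hT', mul_zero]

lemma exists_polynomial_listWplus_cons_insert {a : F} (ha : a ∈ I) {l : List F} {K : Finset F}
    (hK : l.countP (· ∈ I) = #K)
    (hl : ∀ κ ∈ K, ∃ p : F[X], HasTopRatio l.length (la - l.sum + ((l.length : F) - #K) * yy) p ∧
      ∀ s ∉ K.erase κ, p.eval s = listWplus la yy I l (insert s (K.erase κ))) :
    ∃ p : F[X], HasTopRatio (l.length + 1) (la - a - l.sum + ((l.length : F) - #K) * yy) p ∧
      ∀ s ∉ K, p.eval s = listWplus la yy I (a :: l) (insert s K) := by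
  have hweight : (listWeight I l : F) = 2 * #K - l.length := by simp [listWeight, hK]
  choose! p hptop hpeval using hl
  set f : F → F := fun s => yy * (la + s - a - listWeight I l * yy) * (l.map (s - ·)).prod with hf
  set u : F[X] := C (yy * (∏ b ∈ K, (b - a + yy)) * listWplus la yy I l K) *
    ((X + C (la - a - listWeight I l * yy)) * (l.map fun b => X - C b).prod) with hu
  set v : F → F[X] := fun κ => C (f κ * ∏ b ∈ K.erase κ, ((κ - b + yy) / (κ - b) * (b - a + yy))) *
    ((X + C (yy - a)) * p κ) with hv
  have hueval (s : F) : u.eval s = f s * (∏ b ∈ K, (b - a + yy)) * listWplus la yy I l K := by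
    simp only [hu, hf, eval_mul, eval_add, eval_sub, eval_X, eval_C, eval_list_prod, List.map_map,
      Function.comp_def]
    ring
  have hveval (κ s : F) : (v κ).eval s = f κ *
      (∏ b ∈ K.erase κ, ((κ - b + yy) / (κ - b) * (b - a + yy))) *
        ((s - a + yy) * (p κ).eval s) := by
    simp only [hv, eval_mul, eval_C, eval_add, eval_X]
    ring
  have hutop : HasTopRatio (l.length + 1) (la - a - listWeight I l * yy - l.sum) u := by
    rw [add_comm, sub_eq_add_neg _ l.sum]
    exact ((HasTopRatio.X_add_C _).mul (HasTopRatio.list_prod_X_sub_C l)).C_mul _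
  obtain ⟨q, hq, hqeval⟩ := hutop.exists_eval_eq_add_sum (v := v) (K := K) (y := yy)
    (fun κ hκ => by
      convert ((HasTopRatio.X_add_C (yy - a)).mul (hptop κ hκ)).C_mul _ using 1
      · rw [add_comm]
      · rw [hweight]; ring)
    (fun κ hκ => by
      rw [hueval, hveval, hpeval κ hκ κ (by simp), Finset.insert_erase hκ, Finset.prod_mul_distrib,
        ← Finset.mul_prod_erase K _ hκ]
      ring)
  refine ⟨q, by convert hq using 1; rw [hweight]; ring, fun s hs => ?_⟩
  rw [hqeval s hs, hueval, listWplus_cons_of_mem ha, Finset.sum_insert hs, Finset.erase_insert hs,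
    Finset.prod_mul_distrib]
  congr 1
  · ring
  · refine Finset.sum_congr rfl fun κ hκ => ?_
    have hs' : s ∉ K.erase κ := fun h => hs (Finset.mem_of_mem_erase h)
    rw [hveval, hpeval κ hκ s hs', Finset.erase_insert_of_ne (ne_of_mem_of_not_mem hκ hs).symm,
      Finset.prod_insert hs']
    ring

/-- The apparent poles at `s ∈ K` cancel in the symmetrization. -/
lemma exists_polynomial_listWplus_insert (la yy : F) (I : Finset F) (l : List F) :
    ∀ K : Finset F, l.countP (· ∈ I) = #K + 1 →
      ∃ p : F[X], HasTopRatio l.length (la - l.sum + ((l.length : F) - #K - 1) * yy) p ∧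
        ∀ s ∉ K, p.eval s = listWplus la yy I l (insert s K) := by
  induction l with
  | nil => simp
  | cons a l ih =>
    intro K hK
    by_cases ha : a ∈ I
    · rw [List.countP_cons_of_pos (by simpa using ha)] at hK
      have hK' : l.countP (· ∈ I) = #K := by omega
      obtain ⟨p, hp, hpeval⟩ := exists_polynomial_listWplus_cons_insert (la := la) (yy := yy) ha hK'
        fun κ hκ => by
          have hcard := Finset.card_erase_add_one hκ
          obtain ⟨p, hp, hpeval⟩ := ih (K.erase κ) (hK'.trans hcard.symm)
          refine ⟨p, ?_, hpeval⟩
          rwa [← hcard, Nat.cast_add_one, ← sub_sub]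
      refine ⟨p, ?_, hpeval⟩
      convert hp using 1
      · exact List.length_cons
      · rw [List.length_cons, List.sum_cons]
        push_cast
        ring
    · rw [List.countP_cons_of_neg (by simpa using ha)] at hK
      obtain ⟨p, hp, hpeval⟩ := ih K hK
      refine ⟨C (∏ b ∈ K, (b - a + yy)) * ((X + C (yy - a)) * p), ?_, fun s hs => ?_⟩
      · convert ((HasTopRatio.X_add_C (yy - a)).mul hp).C_mul (∏ b ∈ K, (b - a + yy)) using 1
        · rw [List.length_cons, add_comm]
        · rw [List.length_cons, List.sum_cons]
          push_cast
          ring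
      · rw [listWplus_cons_of_notMem ha, Finset.prod_insert hs, eval_mul, eval_mul, hpeval s hs,
          eval_add, eval_C, eval_C, eval_X]
        ring

lemma sum_residues_listWplus (I : Finset F) {l : List F} (hl : (x :: l).Nodup)
    (hg : ∀ a ∈ x :: l, ∀ b ∈ x :: l, a - b + yy ≠ 0) {K : Finset F} (hK : K ⊆ l.toFinset)
    (hc : l.countP (· ∈ I) = #K + 1) :
    ∑ s ∈ (x :: l).toFinset \ K, (la + x - s - (2 * #K - l.length + 1) * yy) *
      listWplus la yy I l (insert s K) /
        ((∏ b ∈ ((x :: l).toFinset \ K).erase s, (s - b)) * ∏ b ∈ K, (s - b + yy)) = 0 := by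
  have hy : yy ≠ 0 := by simpa using hg x (by simp) x (by simp)
  obtain ⟨p, hp, hpeval⟩ := exists_polynomial_listWplus_insert la yy I l K hc
  have hZ : #(x :: l).toFinset = l.length + 1 := List.toFinset_card_of_nodup hl
  have hZsum : ∑ s ∈ (x :: l).toFinset, s = x + l.sum := by
    rw [List.sum_toFinset _ hl, List.map_id', List.sum_cons]
  have htop : HasTopRatio #(x :: l).toFinset (#K * yy - ∑ s ∈ (x :: l).toFinset, s)
      (C (-1) * ((X + C (-(la + x - (2 * #K - l.length + 1) * yy))) * p)) := by
    convert ((HasTopRatio.X_add_C _).mul hp).C_mul (-1) using 1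
    · rw [hZ, add_comm]
    · rw [hZsum]; ring
  have hKZ : K ⊆ (x :: l).toFinset := hK.trans (by simp)
  have hne : ∀ a ∈ (x :: l).toFinset, ∀ b ∈ K, a - b + yy ≠ 0 := fun a ha b hb =>
    hg a (List.mem_toFinset.1 ha) b (List.mem_toFinset.1 (hKZ hb))
  rw [← htop.sum_sdiff_eval_div_eq_zero hKZ hne fun b hb => ?_]
  · refine Finset.sum_congr rfl fun s hs => ?_
    rw [eval_mul, eval_mul, hpeval s (Finset.mem_sdiff.1 hs).2, eval_add, eval_C, eval_C, eval_X]
    ring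
  · have hbK : b - yy ∉ K := fun h => hne _ (hKZ h) b hb (by ring)
    rw [eval_mul, eval_mul, hpeval _ hbK, listWplus_eq_zero_of_sub_mem hy
      (List.mem_toFinset.1 (hK hb)) (Finset.mem_insert_of_mem hb) (Finset.mem_insert_self _ _),
      mul_zero, mul_zero]

end Recursion

section Pairing

open Finset

lemma sum_powerset_sum_erase {ι M : Type*} [DecidableEq ι] [AddCommMonoid M] (Z : Finset ι)
    (f : ι → Finset ι → M) :
    ∑ K ∈ Z.powerset, ∑ s ∈ K, f s (K.erase s) = ∑ K ∈ Z.powerset, ∑ s ∈ Z \ K, f s K := by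
  rw [Finset.sum_sigma', Finset.sum_sigma']
  exact Finset.sum_bij' (fun p _ => ⟨p.1.erase p.2, p.2⟩) (fun p _ => ⟨insert p.2 p.1, p.2⟩)
    (by grind) (by grind)
    (fun ⟨_, _⟩ hp => by simp [insert_erase (mem_sigma.1 hp).2])
    (fun ⟨_, _⟩ hp => by simp [erase_insert (mem_sdiff.1 (mem_sigma.1 hp).2).2])
    (fun _ _ => rfl)

variable {F : Type*} [Field F] [DecidableEq F]

/-- The product `R_K Q_K e_k²` of denominators, with `Z` the set of the `z_a` and `K` the set of the
`t_r`; here `e_k` has been merged once with `Q_K` into a product over `b ∈ Z`. -/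
def pairingDen (yy : F) (Z K : Finset F) : F :=
  (∏ a ∈ K, ((∏ b ∈ Z \ K, (a - b)) * ∏ b ∈ Z, (a - b + yy))) * ∏ a ∈ K, ∏ b ∈ K, (a - b + yy)

/-- The sum over all fixed points of the products of the numerators of `W̃⁺_I` and `W̃⁻_J`, divided
by `R Q e_k²`. -/
def pairing (la yy : F) (I J : Finset F) (l : List F) : F :=
  ∑ K ∈ l.toFinset.powerset,
    listWplus la yy I l K * listWminus la yy J l K / pairingDen yy l.toFinset K

/-- The product of the values `f (w(i, I))` over the entries `i ∈ I` of `l`. -/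
def weightProd {ι S : Type*} [DecidableEq ι] [CommMonoid S] (f : ℤ → S) (I : Finset ι) : List ι → S
  | [] => 1
  | a :: l => if a ∈ I then f (listWeight I l) * weightProd f I l else weightProd f I l

variable {la yy : F}

lemma pairingDen_insert_left {Z K : Finset F} {x : F} (hx : x ∉ Z) (hK : K ⊆ Z) :
    pairingDen yy (insert x Z) K =
      pairingDen yy Z K * ∏ c ∈ K, ((c - x) * (c - x + yy)) := by
  have hxK : x ∉ K := fun h => hx (hK h)
  have hxZK : x ∉ Z \ K := fun h => hx (Finset.mem_sdiff.1 h).1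
  simp only [pairingDen, Finset.insert_sdiff_of_notMem _ hxK, Finset.prod_insert hx,
    Finset.prod_insert hxZK, Finset.prod_mul_distrib]
  ring

lemma pairingDen_insert_right {Z K : Finset F} {s : F} (hs : s ∈ Z \ K) :
    pairingDen yy Z (insert s K) =
      pairingDen yy Z K * (∏ b ∈ (Z \ K).erase s, (s - b)) * (∏ b ∈ Z, (s - b + yy)) * yy *
        (∏ b ∈ K, (s - b + yy)) * (∏ b ∈ K, (b - s + yy)) / ∏ b ∈ K, (b - s) := by
  have hsK := (Finset.mem_sdiff.1 hs).2
  have hsplit : ∏ a ∈ K, ∏ b ∈ Z \ K, (a - b) =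
      (∏ b ∈ K, (b - s)) * ∏ a ∈ K, ∏ b ∈ (Z \ K).erase s, (a - b) := by
    rw [← Finset.prod_mul_distrib]
    exact Finset.prod_congr rfl fun a _ => (Finset.mul_prod_erase (Z \ K) _ hs).symm
  rw [eq_div_iff (prod_sub_left_ne_zero hsK)]
  simp only [pairingDen, Finset.sdiff_insert, Finset.prod_insert hsK, Finset.prod_mul_distrib,
    hsplit]
  ring

variable {I J : Finset F} {x : F} {l : List F} {K : Finset F}

lemma listWplus_cons_eq_zero_of_subset (hx : x ∈ I) (hK : K ⊆ l.toFinset) :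
    listWplus la yy I (x :: l) K = 0 := by
  rw [listWplus_cons_of_mem hx]
  refine Finset.sum_eq_zero fun s hs => ?_
  rw [List.prod_eq_zero (l := l.map _)
    (List.mem_map.2 ⟨s, List.mem_toFinset.1 (hK hs), sub_self s⟩)]
  ring

lemma listWplus_cons_insert_of_mem (hx : x ∈ I) (hK : K ⊆ l.toFinset) (hxK : x ∉ K) :
    listWplus la yy I (x :: l) (insert x K) =
      yy * (la - listWeight I l * yy) * (l.map (x - ·)).prod *
        (∏ b ∈ K, (x - b + yy) / (x - b) * (b - x + yy)) * listWplus la yy I l K := by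
  have hzero : ∀ s ∈ K, (l.map (s - ·)).prod = 0 := fun s hs =>
    List.prod_eq_zero (List.mem_map.2 ⟨s, List.mem_toFinset.1 (hK hs), sub_self s⟩)
  rw [listWplus_cons_of_mem hx, Finset.sum_insert hxK, Finset.sum_eq_zero fun s hs => by
    rw [hzero s hs, mul_zero, zero_mul, zero_mul], Finset.erase_insert hxK, add_sub_cancel_right,
    add_zero]

lemma listWminus_cons_insert_of_mem (hx : x ∈ J) (hxK : x ∉ K) :
    listWminus la yy J (x :: l) (insert x K) =
      yy * (la - (listWeight J l + 1) * yy) * (l.map (x - · + yy)).prod *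
        (∏ b ∈ K, (b - x + yy)) * listWminus la yy J l K := by
  have hzero : ∀ s ∈ K, ∏ b ∈ (insert x K).erase s, (b - s + yy) / (b - s) * (b - x) = 0 :=
    fun s hs => Finset.prod_eq_zero (i := x) (by grind) (by rw [sub_self, mul_zero])
  have hprod : ∏ b ∈ K, (b - x + yy) / (b - x) * (b - x) = ∏ b ∈ K, (b - x + yy) :=
    Finset.prod_congr rfl fun b hb =>
      div_mul_cancel₀ _ (sub_ne_zero.2 (ne_of_mem_of_not_mem hb hxK))
  rw [listWminus_cons_of_mem hx, Finset.sum_insert hxK, Finset.sum_eq_zero fun s hs => by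
    rw [hzero s hs, mul_zero, zero_mul], Finset.erase_insert hxK, add_sub_cancel_right, add_zero,
    hprod]

lemma listWminus_cons_insert_of_notMem (hx : x ∉ J) :
    listWminus la yy J (x :: l) (insert x K) = 0 := by
  rw [listWminus_cons_of_notMem hx,
    Finset.prod_eq_zero (f := (· - x)) (Finset.mem_insert_self x K) (sub_self x), zero_mul]

lemma pairing_eq_zero_of_countP_ne (h : l.countP (· ∈ I) ≠ l.countP (· ∈ J)) :
    pairing la yy I J l = 0 := by
  refine Finset.sum_eq_zero fun K _ => ?_
  by_cases hK : #K = l.countP (· ∈ I)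
  · rw [listWminus_eq_zero (hK.trans_ne h), mul_zero, zero_div]
  · rw [listWplus_eq_zero hK, zero_mul, zero_div]

lemma pairing_cons_of_mem_of_notMem (hI : x ∈ I) (hJ : x ∉ J) (hxl : x ∉ l) :
    pairing la yy I J (x :: l) = 0 := by
  rw [pairing, List.toFinset_cons, Finset.sum_powerset_insert (by simpa using hxl),
    Finset.sum_eq_zero, Finset.sum_eq_zero, add_zero]
  · intro K _
    rw [listWminus_cons_insert_of_notMem hJ, mul_zero, zero_div]
  · intro K hK
    rw [listWplus_cons_eq_zero_of_subset hI (Finset.mem_powerset.1 hK), zero_mul, zero_div]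

lemma pairing_cons_of_notMem_of_notMem (hI : x ∉ I) (hJ : x ∉ J) (hxl : x ∉ l)
    (hg : ∀ a ∈ l, a - x + yy ≠ 0) :
    pairing la yy I J (x :: l) = pairing la yy I J l := by
  have hxl' : x ∉ l.toFinset := by simpa using hxl
  rw [pairing, List.toFinset_cons, Finset.sum_powerset_insert hxl', add_eq_left.2]
  · refine Finset.sum_congr rfl fun K hK => ?_
    rw [Finset.mem_powerset] at hK
    have hsub := prod_sub_left_ne_zero fun h => hxl' (hK h)
    have hsub_add : ∏ b ∈ K, (b - x + yy) ≠ 0 :=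
      Finset.prod_ne_zero_iff.2 fun b hb => hg b (List.mem_toFinset.1 (hK hb))
    rw [listWplus_cons_of_notMem hI, listWminus_cons_of_notMem hJ, pairingDen_insert_left hxl' hK,
      Finset.prod_mul_distrib]
    field_simp
  · refine Finset.sum_eq_zero fun K _ => ?_
    rw [listWminus_cons_insert_of_notMem hJ, mul_zero, zero_div]

lemma pairing_cons_of_mem_of_mem (hI : x ∈ I) (hJ : x ∈ J) (hl : (x :: l).Nodup)
    (hg : ∀ a ∈ x :: l, ∀ b ∈ x :: l, a - b + yy ≠ 0) :
    pairing la yy I J (x :: l) =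
      (la - listWeight I l * yy) * (la - (listWeight J l + 1) * yy) * pairing la yy I J l := by
  obtain ⟨hxl, hl'⟩ := List.nodup_cons.1 hl
  have hxl' : x ∉ l.toFinset := by simpa using hxl
  have hzero : ∀ K ∈ l.toFinset.powerset, listWplus la yy I (x :: l) K = 0 := fun K hK =>
    listWplus_cons_eq_zero_of_subset hI (Finset.mem_powerset.1 hK)
  rw [pairing, List.toFinset_cons, Finset.sum_powerset_insert hxl',
    Finset.sum_eq_zero fun K hK => by rw [hzero K hK, zero_mul, zero_div], zero_add, pairing,
    Finset.mul_sum]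
  refine Finset.sum_congr rfl fun K hK => ?_
  rw [Finset.mem_powerset] at hK
  have hxK : x ∉ K := fun h => hxl' (hK h)
  have hmem {b : F} (hb : b ∈ l.toFinset) : b ∈ x :: l :=
    List.mem_cons_of_mem x (List.mem_toFinset.1 hb)
  have hx : x ∈ x :: l := List.mem_cons_self
  have hy : yy ≠ 0 := by simpa using hg x hx x hx
  have hx_sub := prod_sub_ne_zero hxK
  have hsub_x := prod_sub_left_ne_zero hxK
  have hx_sub_compl := prod_sub_ne_zero fun h => hxl' (Finset.sdiff_subset (t := K) h)
  have hsub_x_add : ∏ b ∈ K, (b - x + yy) ≠ 0 :=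
    Finset.prod_ne_zero_iff.2 fun b hb => hg b (hmem (hK hb)) x hx
  have hx_sub_add : ∏ b ∈ K, (x - b + yy) ≠ 0 :=
    Finset.prod_ne_zero_iff.2 fun b hb => hg x hx b (hmem (hK hb))
  have hx_sub_add_all : ∏ b ∈ l.toFinset, (x - b + yy) ≠ 0 :=
    Finset.prod_ne_zero_iff.2 fun b hb => hg x hx b (hmem hb)
  rw [listWplus_cons_insert_of_mem hI hK hxK, listWminus_cons_insert_of_mem hJ hxK,
    pairingDen_insert_right (by simp [hxK]), pairingDen_insert_left hxl' hK,
    Finset.insert_sdiff_of_notMem _ hxK, Finset.erase_insert (by simp [hxl]),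
    Finset.prod_insert hxl', sub_self, zero_add, ← List.prod_toFinset _ hl',
    ← List.prod_toFinset _ hl', ← Finset.prod_sdiff hK]
  simp only [Finset.prod_mul_distrib, Finset.prod_div_distrib]
  generalize listWplus la yy I l K = W₁
  generalize listWminus la yy J l K = W₂
  generalize pairingDen yy l.toFinset K = D
  field_simp

lemma listWplus_mul_listWminus_div_pairingDen (hx : x ∉ I) (hl : (x :: l).Nodup)
    (hg : ∀ a ∈ x :: l, ∀ b ∈ x :: l, a - b + yy ≠ 0) (hK : K ⊆ l.toFinset) {s : F}
    (hs : s ∈ (x :: l).toFinset \ K) :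
    listWplus la yy I (x :: l) (insert s K) *
        (yy * (la + x - s - (listWeight J l + 1) * yy) * (l.map (s - · + yy)).prod *
          (∏ b ∈ K, (b - s + yy) / (b - s) * (b - x)) * listWminus la yy J l K) /
        pairingDen yy (x :: l).toFinset (insert s K) =
      (∏ b ∈ K, (b - x + yy) * (b - x)) * listWminus la yy J l K /
          pairingDen yy (x :: l).toFinset K *
        ((la + x - s - (listWeight J l + 1) * yy) * listWplus la yy I l (insert s K) /
          ((∏ b ∈ ((x :: l).toFinset \ K).erase s, (s - b)) * ∏ b ∈ K, (s - b + yy))) := by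
  obtain ⟨hxl, hl'⟩ := List.nodup_cons.1 hl
  obtain ⟨hsZ, hsK⟩ := Finset.mem_sdiff.1 hs
  have hs' : s ∈ x :: l := List.mem_toFinset.1 hsZ
  have hmem {b : F} (hb : b ∈ l.toFinset) : b ∈ x :: l :=
    List.mem_cons_of_mem x (List.mem_toFinset.1 hb)
  have hy : yy ≠ 0 := by simpa using hg s hs' s hs'
  have hsub_s := prod_sub_left_ne_zero hsK
  have hsub_s_add : ∏ b ∈ K, (b - s + yy) ≠ 0 :=
    Finset.prod_ne_zero_iff.2 fun b hb => hg b (hmem (hK hb)) s hs'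
  have hs_sub_add_all : ∏ b ∈ l.toFinset, (s - b + yy) ≠ 0 :=
    Finset.prod_ne_zero_iff.2 fun b hb => hg s hs' b (hmem hb)
  have hs_sub_x_add : s - x + yy ≠ 0 := hg s hs' x List.mem_cons_self
  rw [listWplus_cons_of_notMem hx, pairingDen_insert_right hs, Finset.prod_insert hsK,
    ← List.prod_toFinset _ hl', List.toFinset_cons, Finset.prod_insert (by simpa using hxl)]
  simp only [Finset.prod_mul_distrib, Finset.prod_div_distrib]
  generalize listWplus la yy I l _ = W₁
  generalize listWminus la yy J l K = W₂
  generalize pairingDen yy _ K = D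
  field_simp

lemma pairing_cons_of_notMem_of_mem (hI : x ∉ I) (hJ : x ∈ J) (hl : (x :: l).Nodup)
    (hg : ∀ a ∈ x :: l, ∀ b ∈ x :: l, a - b + yy ≠ 0) :
    pairing la yy I J (x :: l) = 0 := by
  by_cases hc : (x :: l).countP (· ∈ I) = (x :: l).countP (· ∈ J)
  swap
  · exact pairing_eq_zero_of_countP_ne hc
  rw [List.countP_cons_of_neg (by simpa using hI),
    List.countP_cons_of_pos (by simpa using hJ)] at hc
  let f : F → Finset F → F := fun s K => listWplus la yy I (x :: l) (insert s K) *
    (yy * (la + x - s - (listWeight J l + 1) * yy) * (l.map (s - · + yy)).prod *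
      (∏ b ∈ K, (b - s + yy) / (b - s) * (b - x)) * listWminus la yy J l K) /
        pairingDen yy (x :: l).toFinset (insert s K)
  have hsum : pairing la yy I J (x :: l) =
      ∑ K ∈ (x :: l).toFinset.powerset, ∑ s ∈ K, f s (K.erase s) := by
    refine Finset.sum_congr rfl fun K _ => ?_
    rw [listWminus_cons_of_mem hJ, Finset.mul_sum, Finset.sum_div]
    refine Finset.sum_congr rfl fun s hs => ?_
    simp only [f, Finset.insert_erase hs]
  rw [hsum, sum_powerset_sum_erase]
  refine Finset.sum_eq_zero fun K hK => ?_
  by_cases hxK : x ∈ K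
  · refine Finset.sum_eq_zero fun s _ => ?_
    simp only [f, Finset.prod_eq_zero hxK, sub_self, mul_zero, zero_mul, zero_div]
  by_cases hcK : #K = l.countP (· ∈ J)
  swap
  · simp only [f, listWminus_eq_zero hcK, mul_zero, zero_div, Finset.sum_const_zero]
  have hKl : K ⊆ l.toFinset := by
    rw [Finset.mem_powerset, List.toFinset_cons] at hK
    exact (Finset.subset_insert_iff_of_notMem hxK).1 hK
  have hweight : (listWeight J l : F) = 2 * #K - l.length := by
    rw [listWeight, ← hcK]
    push_cast
    rfl
  have hres := sum_residues_listWplus (la := la) I hl hg hKl (by omega)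
  simp only [f]
  rw [Finset.sum_congr rfl fun s hs =>
    listWplus_mul_listWminus_div_pairingDen (J := J) hI hl hg hKl hs, ← Finset.mul_sum, hweight,
    hres, mul_zero]

lemma pairing_eq_ite (I J : Finset F) (hl : l.Nodup)
    (hg : ∀ a ∈ l, ∀ b ∈ l, a - b + yy ≠ 0) :
    pairing la yy I J l = if ∀ a ∈ l, (a ∈ I ↔ a ∈ J) then
      weightProd (fun w => (la - w * yy) * (la - (w + 1) * yy)) I l else 0 := by
  induction l with
  | nil => simp [pairing, listWplus, listWminus, shuffleSum, pairingDen, weightProd]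
  | cons x l ih =>
    have hxl := (List.nodup_cons.1 hl).1
    have hg' : ∀ a ∈ l, ∀ b ∈ l, a - b + yy ≠ 0 := fun a ha b hb =>
      hg a (List.mem_cons_of_mem x ha) b (List.mem_cons_of_mem x hb)
    simp only [List.forall_mem_cons, weightProd]
    by_cases hI : x ∈ I <;> by_cases hJ : x ∈ J
    · rw [pairing_cons_of_mem_of_mem hI hJ hl hg, ih (List.nodup_cons.1 hl).2 hg']
      by_cases h : ∀ a ∈ l, (a ∈ I ↔ a ∈ J)
      · simp [hI, hJ, listWeight_congr h]
      · simp [h]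
    · simp [pairing_cons_of_mem_of_notMem hI hJ hxl, hI, hJ]
    · simp [pairing_cons_of_notMem_of_mem hI hJ hl hg, hI, hJ]
    · rw [pairing_cons_of_notMem_of_notMem hI hJ hxl fun a ha =>
        hg a (List.mem_cons_of_mem x ha) x List.mem_cons_self, ih (List.nodup_cons.1 hl).2 hg']
      simp [hI, hJ]

end Pairing

section SymSum

variable {ι X S : Type*} [CommSemiring S] {n k : ℕ}

/-- The symmetrization of `∏_r φ_r(t_r) ∏_{a < b} g(t_a, t_b)` over all permutations of the
`t_r`. -/
def symSum (φ : Fin k → X → S) (g : X → X → S) (t : Fin k → X) : S :=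
  ∑ σ : Equiv.Perm (Fin k),
    (∏ r, φ r (t (σ r))) * ∏ a, ∏ b ∈ Finset.Ioi a, g (t (σ a)) (t (σ b))

lemma symSum_succ (φ : Fin (k + 1) → X → S) (g : X → X → S) (t : Fin (k + 1) → X) :
    symSum φ g t = ∑ p, φ 0 (t p) * (∏ r : Fin k, g (t p) (t (Equiv.swap 0 p r.succ))) *
      symSum (fun r => φ r.succ) g fun r => t (Equiv.swap 0 p r.succ) := by
  rw [symSum, ← Equiv.sum_comp Equiv.Perm.decomposeFin.symm, Fintype.sum_prod_type]
  refine Finset.sum_congr rfl fun p _ => ?_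
  rw [symSum, Finset.mul_sum]
  refine Finset.sum_congr rfl fun σ _ => ?_
  simp only [Fin.prod_univ_succ, Fin.prod_Ioi_zero, Fin.prod_Ioi_succ,
    Equiv.Perm.decomposeFin_symm_apply_zero, Equiv.Perm.decomposeFin_symm_apply_succ]
  rw [Equiv.prod_comp σ fun r : Fin k => g (t p) (t (Equiv.swap 0 p r.succ))]
  ring

lemma symSum_mul (h : X → S) (φ : Fin k → X → S) (g : X → X → S) (t : Fin k → X) :
    symSum (fun r x => h x * φ r x) g t = (∏ r, h (t r)) * symSum φ g t := by
  rw [symSum, symSum, Finset.mul_sum]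
  refine Finset.sum_congr rfl fun σ _ => ?_
  rw [Finset.prod_mul_distrib, Equiv.prod_comp σ fun r => h (t r), mul_assoc]

lemma image_univ_erase_eq_image_swap_succ [DecidableEq X] {t : Fin (k + 1) → X}
    (ht : Function.Injective t) (p : Fin (k + 1)) :
    (Finset.univ.image t).erase (t p) =
      Finset.univ.image fun r : Fin k => t (Equiv.swap 0 p r.succ) := by
  have h : Finset.univ.erase p = Finset.univ.image fun r : Fin k => Equiv.swap 0 p r.succ := by
    ext i
    simp only [Finset.mem_erase, Finset.mem_univ, and_true, Finset.mem_image, true_and,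
      Equiv.swap_apply_eq_iff, Fin.exists_succ_eq, ne_eq, Equiv.swap_apply_left]
  rw [← Finset.image_erase ht, h, Finset.image_image]
  rfl

lemma exists_strictMono_succ {e : Fin k → Fin (n + 1)} (he : StrictMono e) (h0 : ∀ r, e r ≠ 0) :
    ∃ e' : Fin k → Fin n, StrictMono e' ∧ ∀ r, e r = (e' r).succ :=
  ⟨fun r => (e r).pred (h0 r), fun _ _ hab => Fin.pred_lt_pred_iff.2 (he hab),
    fun r => (Fin.succ_pred (e r) (h0 r)).symm⟩

variable [DecidableEq ι]

lemma listWeight_ofFn (J : Finset ι) (zz : Fin n → ι) :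
    listWeight J (List.ofFn zz) = ∑ i, if zz i ∈ J then 1 else -1 := by
  induction n with
  | zero => simp [listWeight]
  | succ n ih =>
    rw [Fin.sum_univ_succ, ← ih fun i => zz i.succ, List.ofFn_succ, listWeight, listWeight,
      List.countP_cons, List.length_cons]
    simp only [decide_eq_true_eq]
    split_ifs <;> push_cast <;> ring

lemma prod_eq_weightProd (f : ℤ → S) (J : Finset ι) (zz : Fin n → ι) :
    (∏ i, if zz i ∈ J then f (∑ j ∈ Finset.Ioi i, if zz j ∈ J then 1 else -1) else 1) =
      weightProd f J (List.ofFn zz) := by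
  induction n with
  | zero => simp [weightProd]
  | succ n ih =>
    rw [List.ofFn_succ, weightProd, Fin.prod_univ_succ,
      Fin.sum_Ioi_zero (f := fun j => if zz j ∈ J then (1 : ℤ) else -1), ← ih, listWeight_ofFn]
    simp only [Fin.sum_Ioi_succ fun j => if zz j ∈ J then (1 : ℤ) else -1]
    split_ifs <;> simp

/-- The contribution of a variable with value `x`, assigned to the position `i`, to the summands of
`shuffleSum α γ g β J (List.ofFn zz)`, apart from the factors `g`. -/
def slotProd (α γ : X → ι → S) (β : ℤ → X → ι → S) (J : Finset ι) (zz : Fin n → ι) (i : Fin n)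
    (x : X) : S :=
  ∏ a, if a < i then α x (zz a)
    else if a = i then β (∑ j ∈ Finset.Ioi i, if zz j ∈ J then 1 else -1) x (zz a)
    else γ x (zz a)

lemma slotProd_zero (α γ : X → ι → S) (β : ℤ → X → ι → S) (J : Finset ι) (zz : Fin (n + 1) → ι)
    (x : X) :
    slotProd α γ β J zz 0 x = β (listWeight J (List.ofFn fun i => zz i.succ)) x (zz 0) *
      ((List.ofFn fun i => zz i.succ).map (γ x)).prod := by
  rw [slotProd, Fin.prod_univ_succ, listWeight_ofFn, List.map_ofFn, List.prod_ofFn,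
    Fin.sum_Ioi_zero (f := fun j => if zz j ∈ J then (1 : ℤ) else -1)]
  simp [Fin.succ_ne_zero]

lemma slotProd_succ (α γ : X → ι → S) (β : ℤ → X → ι → S) (J : Finset ι) (zz : Fin (n + 1) → ι)
    (i : Fin n) :
    slotProd α γ β J zz i.succ =
      fun x => α x (zz 0) * slotProd α γ β J (fun i => zz i.succ) i x := by
  funext x
  rw [slotProd, Fin.prod_univ_succ,
    Fin.sum_Ioi_succ (f := fun j => if zz j ∈ J then (1 : ℤ) else -1)]
  simp [slotProd]

lemma symSum_slotProd_eq_shuffleSum [DecidableEq X] (α γ : X → ι → S) (g : X → X → S)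
    (β : ℤ → X → ι → S) (J : Finset ι) {zz : Fin n → ι} {e : Fin k → Fin n} (he : StrictMono e)
    (hJ : ∀ i, zz i ∈ J ↔ ∃ r, e r = i) {t : Fin k → X} (ht : Function.Injective t) :
    symSum (fun r => slotProd α γ β J zz (e r)) g t =
      shuffleSum α γ g β J (List.ofFn zz) (Finset.univ.image t) := by
  induction n generalizing k with
  | zero =>
    cases k with
    | zero => simp [symSum, shuffleSum]
    | succ k => exact (e 0).elim0
  | succ n ih =>
    rw [List.ofFn_succ, shuffleSum]
    split_ifs with h0
    · obtain ⟨r₀, hr₀⟩ := (hJ 0).1 h0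
      obtain ⟨k, rfl⟩ : ∃ k', k = k' + 1 := ⟨k - 1, by have := r₀.pos; omega⟩
      have he0 : e 0 = 0 := le_antisymm (hr₀ ▸ he.monotone (Fin.zero_le r₀)) (Fin.zero_le _)
      obtain ⟨e', he', hsucc⟩ := exists_strictMono_succ (he.comp (Fin.strictMono_succ))
        fun r => (he0 ▸ he r.succ_pos).ne'
      simp only [Function.comp_apply] at hsucc
      have hJ' (i : Fin n) : zz i.succ ∈ J ↔ ∃ r, e' r = i := by
        rw [hJ, Fin.exists_fin_succ]
        simp [he0, hsucc, (Fin.succ_ne_zero i).symm]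
      rw [symSum_succ, Finset.sum_image ht.injOn]
      refine Finset.sum_congr rfl fun p _ => ?_
      have ht' : Function.Injective fun r : Fin k => t (Equiv.swap 0 p r.succ) :=
        ht.comp ((Equiv.injective _).comp (Fin.succ_injective _))
      simp only [he0, hsucc, slotProd_zero, slotProd_succ]
      rw [symSum_mul (fun x => α x (zz 0)), ih he' hJ' ht',
        image_univ_erase_eq_image_swap_succ ht, Finset.prod_image ht'.injOn,
        Finset.prod_mul_distrib]
      ring
    · obtain ⟨e', he', hsucc⟩ := exists_strictMono_succ he fun r h => h0 ((hJ 0).2 ⟨r, h⟩)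
      have hJ' (i : Fin n) : zz i.succ ∈ J ↔ ∃ r, e' r = i := by simp [hJ, hsucc]
      simp only [hsucc, slotProd_succ]
      rw [symSum_mul (fun x => α x (zz 0)), ih he' hJ' ht, Finset.prod_image ht.injOn]

end SymSum

section Weight

variable {n k : ℕ}

lemma w_eq_sum (i : Fin n) (I : II n k) :
    w i I = ∑ j ∈ Finset.Ioi i, if j ∈ I.1 then 1 else -1 := by
  have hfilter (p : Fin n → Prop) [DecidablePred p] :
      Finset.univ.filter (fun j => i < j ∧ p j) = (Finset.Ioi i).filter p := by
    ext
    simp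
  rw [w, Finset.sum_ite, hfilter, hfilter, Finset.sum_const, Finset.sum_const]
  simp [add_comm]

lemma mem_act_revPerm_inv (I : II n k) (j : Fin n) :
    j ∈ (act Fin.revPerm⁻¹ I).1 ↔ j.rev ∈ I.1 := by
  rw [act, Finset.mem_map_equiv]
  rfl

lemma elt_strictMono (I : II n k) : StrictMono (elt I) :=
  (I.1.orderEmbOfFin I.2).strictMono

lemma elt_mem (I : II n k) (r : Fin k) : elt I r ∈ I.1 :=
  Finset.orderEmbOfFin_mem _ _ _

lemma exists_elt_eq_iff (I : II n k) (i : Fin n) : (∃ r, elt I r = i) ↔ i ∈ I.1 :=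
  Set.ext_iff.1 (Finset.range_orderEmbOfFin I.1 I.2) i

lemma elt_act_revPerm_inv (I : II n k) (r : Fin k) :
    elt (act Fin.revPerm⁻¹ I) r = (elt I r.rev).rev := by
  have h := Finset.orderEmbOfFin_unique (act Fin.revPerm⁻¹ I).2 (f := fun r => (elt I r.rev).rev)
    (fun r => by rw [mem_act_revPerm_inv, Fin.rev_rev]; exact elt_mem I _)
    (fun a b hab => Fin.rev_lt_rev.2 (elt_strictMono I (Fin.rev_lt_rev.2 hab)))
  exact (congrFun h r).symm

lemma w_rev_act_revPerm_inv (I : II n k) {i : Fin n} (hi : i ∈ I.1) :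
    w i.rev (act Fin.revPerm⁻¹ I) = 2 * k - n - 1 - w i I := by
  have hbelow : w i.rev (act Fin.revPerm⁻¹ I) =
      ∑ j ∈ Finset.Iio i, if j ∈ I.1 then 1 else -1 := by
    rw [w_eq_sum]
    exact Finset.sum_equiv Fin.revPerm (by simp [Fin.rev_lt_iff]) (by simp [mem_act_revPerm_inv])
  have htotal : ∑ j : Fin n, (if j ∈ I.1 then (1 : ℤ) else -1) = 2 * k - n := by
    rw [Finset.sum_ite, Finset.sum_const, Finset.sum_const, Finset.filter_univ_mem, I.2,
      ← Finset.compl_filter, Finset.filter_univ_mem, Finset.card_compl, I.2, Fintype.card_fin,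
      nsmul_one, smul_neg, nsmul_one, Nat.cast_sub (I.2 ▸ card_finset_fin_le I.1)]
    ring
  have hsplit : (Finset.univ : Finset (Fin n)) = insert i (Finset.Iio i ∪ Finset.Ioi i) := by
    grind
  rw [hsplit, Finset.sum_insert (by simp), Finset.sum_union (Finset.disjoint_left.2 (by grind)),
    if_pos hi, ← hbelow, ← w_eq_sum] at htotal
  linarith

lemma prod_prod_Ioi_rev {M : Type*} [CommMonoid M] (f : Fin k → Fin k → M) :
    ∏ a : Fin k, ∏ b ∈ Finset.Ioi a, f a.rev b.rev = ∏ a, ∏ b ∈ Finset.Ioi a, f b a := by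
  have hIoi (f : Fin k → Fin k → M) (a : Fin k) :
      ∏ b ∈ Finset.Ioi a, f a b = ∏ b, if a < b then f a b else 1 := by
    rw [← Finset.filter_lt_eq_Ioi, Finset.prod_filter]
  rw [Finset.prod_congr rfl fun a _ => hIoi (fun a b : Fin k => f a.rev b.rev) a,
    Finset.prod_congr rfl fun a _ => hIoi (fun a b => f b a) a, Finset.prod_comm,
    ← Equiv.prod_comp Fin.revPerm]
  refine Finset.prod_congr rfl fun a _ => ?_
  rw [← Equiv.prod_comp Fin.revPerm]
  simp [Fin.rev_lt_rev]

lemma mul_prod_ite_eq {M : Type*} [CommMonoid M] (c : M) (i : Fin n) (f : Fin n → M) :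
    c * ∏ a, f a = ∏ a, if a = i then c * f a else f a := by
  rw [Finset.prod_ite, ← Finset.mul_prod_erase _ _ (Finset.mem_univ i)]
  simp [Finset.filter_eq', Finset.filter_ne', mul_assoc]

lemma sum_Ioi_image_eq_w {ι : Type*} [DecidableEq ι] {zz : Fin n → ι}
    (hz : Function.Injective zz) (I : II n k) (i : Fin n) :
    (∑ j ∈ Finset.Ioi i, if zz j ∈ I.1.image zz then (1 : ℤ) else -1) = w i I := by
  simp only [w_eq_sum, hz.mem_finset_image]

variable {A : Type*} [CommRing A] [DecidableEq A] {zz : Fin n → A}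

lemma mul_prod_lFactor (hz : Function.Injective zz) (I : II n k) (la yy : A) (t : Fin k → A)
    (r : Fin k) :
    yy * ∏ a, lFactor I la t zz yy r a =
      slotProd (fun t a => t - a + yy) (fun t a => t - a) (fun w s a => yy * (la + s - a - w * yy))
        (I.1.image zz) zz (elt I r) (t r) := by
  rw [mul_prod_ite_eq yy (elt I r), slotProd]
  refine Finset.prod_congr rfl fun a _ => ?_
  rw [lFactor, sum_Ioi_image_eq_w hz]
  rcases lt_trichotomy a (elt I r) with h | h | h
  · simp [h, h.ne]
  · simp [h]
  · simp [h.ne', h.not_gt]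

lemma neg_mul_prod_lFactor_rev (hz : Function.Injective zz) (I : II n k) (la yy : A)
    (t : Fin k → A) (r : Fin k) :
    -yy * ∏ a, lFactor (act Fin.revPerm⁻¹ I) (-la - (((n : ℤ) - 2 * (k : ℤ) : ℤ) : A) * yy) t
        (fun a => zz a.rev) yy r a =
      slotProd (fun t a => t - a) (fun t a => t - a + yy)
        (fun w s a => yy * (la + a - s - (w + 1) * yy)) (I.1.image zz) zz (elt I r.rev) (t r) := by
  rw [← Equiv.prod_comp Fin.revPerm, mul_prod_ite_eq (-yy) (elt I r.rev), slotProd]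
  refine Finset.prod_congr rfl fun a _ => ?_
  rw [lFactor, sum_Ioi_image_eq_w hz, elt_act_revPerm_inv, w_rev_act_revPerm_inv I (elt_mem I _)]
  simp only [Fin.revPerm_apply, Fin.rev_rev, Fin.rev_lt_rev, Fin.rev_inj]
  rcases lt_trichotomy a (elt I r.rev) with h | h | h
  · simp [h, h.ne, h.not_gt]
  · simp only [h, lt_irrefl, if_false, if_true]
    push_cast
    ring
  · simp [h, h.ne', h.not_gt]

variable {F : Type*} [Field F] [DecidableEq F] {t : Fin k → F} {zz : Fin n → F}

lemma W_eq_listWplus (I : II n k) (la yy : F) (ht : Function.Injective t)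
    (hz : Function.Injective zz) :
    W I la t zz yy =
      listWplus la yy (I.1.image zz) (List.ofFn zz) (Finset.univ.image t) := by
  rw [listWplus, ← symSum_slotProd_eq_shuffleSum _ _ _ _ _ (elt_strictMono I)
    (fun i => by rw [exists_elt_eq_iff, hz.mem_finset_image]) ht, W, symSum, Finset.mul_sum]
  refine Finset.sum_congr rfl fun σ _ => ?_
  rw [weightTerm, ← mul_assoc, ← Fin.prod_const, ← Finset.prod_mul_distrib]
  simp only [mul_prod_lFactor hz, Ring.inverse_eq_inv', div_eq_mul_inv]

lemma Wσ_revPerm_eq_listWminus (I : II n k) (la yy : F) (ht : Function.Injective t)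
    (hz : Function.Injective zz) :
    (-1) ^ k * Wσ Fin.revPerm I (-la - (((n : ℤ) - 2 * (k : ℤ) : ℤ) : F) * yy) t zz yy =
      listWminus la yy (I.1.image zz) (List.ofFn zz) (Finset.univ.image t) := by
  rw [listWminus, ← symSum_slotProd_eq_shuffleSum _ _ _ _ _ (elt_strictMono I)
    (fun i => by rw [exists_elt_eq_iff, hz.mem_finset_image]) ht, Wσ, W, symSum, ← mul_assoc,
    ← mul_pow, neg_one_mul, Finset.mul_sum, ← Equiv.sum_comp (Equiv.mulRight Fin.revPerm)]
  refine Finset.sum_congr rfl fun σ _ => ?_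
  rw [weightTerm, ← mul_assoc, ← Fin.prod_const, ← Finset.prod_mul_distrib,
    ← Equiv.prod_comp Fin.revPerm]
  simp only [Fin.revPerm_apply, neg_mul_prod_lFactor_rev hz, Ring.inverse_eq_inv',
    ← div_eq_mul_inv, Equiv.coe_mulRight, Equiv.Perm.mul_apply, Fin.rev_rev]
  rw [prod_prod_Ioi_rev fun a b => (t (σ a) - t (σ b) + yy) / (t (σ a) - t (σ b))]

end Weight

section FieldOrthogonality

variable {n k : ℕ}

lemma act_one_inv (I : II n k) : act (1 : Equiv.Perm (Fin n))⁻¹ I = I :=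
  Subtype.ext (by rw [inv_one]; exact Finset.map_refl)

lemma Cσ_one {A : Type*} [CommRing A] (r : ℤ) (I : II n k) (la yy : A) :
    Cσ r 1 I la yy = ∏ i ∈ I.1, (la - ((w i I + r : ℤ) : A) * yy) := by
  rw [Cσ, act_one_inv]
  rfl

section Image

variable {ι : Type*} [DecidableEq ι] {zz : Fin n → ι}

lemma image_comp_elt (K : II n k) : Finset.univ.image (fun r => zz (elt K r)) = K.1.image zz := by
  have h : Finset.univ.image (elt K) = K.1 := by
    ext i
    simpa using exists_elt_eq_iff K i
  conv_rhs => rw [← h, Finset.image_image]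
  rfl

lemma countP_mem_image_ofFn (hz : Function.Injective zz) (I : Finset (Fin n)) :
    (List.ofFn zz).countP (· ∈ I.image zz) = I.card := by
  rw [List.countP_eq_length_filter,
    ← List.toFinset_card_of_nodup ((List.nodup_ofFn.2 hz).filter _), List.toFinset_filter,
    ← Finset.card_image_of_injective I hz]
  congr 1
  ext a
  simp only [decide_eq_true_eq, Finset.mem_filter, List.mem_toFinset, List.mem_ofFn,
    and_iff_right_iff_imp]
  exact fun h => (Finset.mem_image.1 h).imp fun _ => And.right

lemma forall_mem_ofFn_mem_image_iff (hz : Function.Injective zz) (I J : II n k) :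
    (∀ a ∈ List.ofFn zz, (a ∈ I.1.image zz ↔ a ∈ J.1.image zz)) ↔ I = J := by
  simp only [List.forall_mem_ofFn_iff, hz.mem_finset_image, Subtype.ext_iff, Finset.ext_iff]

end Image

lemma Cσ_one_mul_Cσ_one_eq_weightProd {A : Type*} [CommRing A] [DecidableEq A] {zz : Fin n → A}
    (hz : Function.Injective zz) (I : II n k) (la yy : A) :
    Cσ 0 1 I la yy * Cσ 1 1 I la yy =
      weightProd (fun w => (la - w * yy) * (la - (w + 1) * yy)) (I.1.image zz) (List.ofFn zz) := by
  simp only [← prod_eq_weightProd, hz.mem_finset_image, ← w_eq_sum, Cσ_one,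
    ← Finset.prod_mul_distrib, Finset.prod_ite_mem, Finset.univ_inter]
  simp

section DecidableField

variable {F : Type*} [Field F] [DecidableEq F] {zz : Fin n → F}

lemma pairingDen_image (hz : Function.Injective zz) (yy : F) (K : II n k) :
    pairingDen yy (Finset.univ.image zz) (K.1.image zz) =
      (∏ a ∈ K.1, ∏ b ∈ K.1ᶜ, (zz a - zz b)) * (∏ a ∈ K.1, ∏ b ∈ K.1ᶜ, (zz a - zz b + yy)) *
        (e (fun r => zz (elt K r)) yy * e (fun r => zz (elt K r)) yy) := by
  have hsdiff : Finset.univ.image zz \ K.1.image zz = K.1ᶜ.image zz := by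
    rw [← Finset.image_sdiff _ _ hz, Finset.compl_eq_univ_sdiff]
  have he : e (fun r => zz (elt K r)) yy = ∏ a ∈ K.1, ∏ b ∈ K.1, (zz a - zz b + yy) := by
    rw [e, ← prod_elt K fun a => ∏ b ∈ K.1, (zz a - zz b + yy)]
    exact Finset.prod_congr rfl fun r _ => prod_elt K fun b => zz (elt K r) - zz b + yy
  have hsplit (a : F) : ∏ b, (a - zz b + yy) =
      (∏ b ∈ K.1, (a - zz b + yy)) * ∏ b ∈ K.1ᶜ, (a - zz b + yy) :=
    (Finset.prod_mul_prod_compl _ _).symm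
  rw [pairingDen, hsdiff, he]
  simp only [Finset.prod_image hz.injOn, hsplit, Finset.prod_mul_distrib]
  ring

lemma sum_listWplus_mul_listWminus_eq_pairing (hz : Function.Injective zz) (la yy : F)
    (I J : II n k) :
    ∑ K : II n k, listWplus la yy (I.1.image zz) (List.ofFn zz) (K.1.image zz) *
        listWminus la yy (J.1.image zz) (List.ofFn zz) (K.1.image zz) /
          pairingDen yy (Finset.univ.image zz) (K.1.image zz) =
      pairing la yy (I.1.image zz) (J.1.image zz) (List.ofFn zz) := by
  have hZ : (List.ofFn zz).toFinset = Finset.univ.image zz := by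
    ext
    simp
  rw [pairing, hZ]
  refine Finset.sum_of_injOn (fun K => K.1.image zz)
    (fun K _ K' _ h => Subtype.ext (Finset.image_injective hz h))
    (fun K _ => by simp) (fun T hT hTK => ?_) fun K _ => rfl
  obtain ⟨K, -, rfl⟩ := Finset.subset_image_iff.1 (Finset.mem_powerset.1 hT)
  rw [listWplus_eq_zero, zero_mul, zero_div]
  intro hcard
  rw [countP_mem_image_ofFn hz, Finset.card_image_of_injective _ hz, I.2] at hcard
  exact hTK ⟨⟨K, hcard⟩, by simp, rfl⟩

lemma Wplus_one_comp_elt (hz : Function.Injective zz) (la yy : F) (I K : II n k) :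
    Wplus 1 I la (fun r => zz (elt K r)) zz yy =
      listWplus la yy (I.1.image zz) (List.ofFn zz) (K.1.image zz) /
        (Cσ 0 1 I la yy * Cσ 1 1 I la yy * e (fun r => zz (elt K r)) yy) := by
  rw [← image_comp_elt K, div_eq_mul_inv,
    ← W_eq_listWplus (t := fun r => zz (elt K r)) I la yy
      (hz.comp (elt_strictMono K).injective) hz, Wplus, Wσ, act_one_inv, Ring.inverse_eq_inv']
  rfl

lemma Wminus_comp_elt (hz : Function.Injective zz) (la yy : F) (J K : II n k) :
    Wminus J la (fun r => zz (elt K r)) zz yy =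
      listWminus la yy (J.1.image zz) (List.ofFn zz) (K.1.image zz) /
        e (fun r => zz (elt K r)) yy := by
  rw [← image_comp_elt K, div_eq_mul_inv,
    ← Wσ_revPerm_eq_listWminus (t := fun r => zz (elt K r)) J la yy
      (hz.comp (elt_strictMono K).injective) hz, Wminus, Ring.inverse_eq_inv']

end DecidableField

lemma sum_Wplus_mul_Wminus_of_field {F : Type*} [Field F] {zz : Fin n → F}
    (hz : Function.Injective zz) {la yy : F} (hg : ∀ a b, zz a - zz b + yy ≠ 0) (I J : II n k)
    (hC : Cσ 0 1 I la yy * Cσ 1 1 I la yy ≠ 0) :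
    ∑ K : II n k, Wplus 1 I la (fun r => zz (elt K r)) zz yy *
        (Wminus J la (fun r => zz (elt K r)) zz yy *
          ((∏ a ∈ K.1, ∏ b ∈ K.1ᶜ, (zz a - zz b))⁻¹ *
            (∏ a ∈ K.1, ∏ b ∈ K.1ᶜ, (zz a - zz b + yy))⁻¹)) =
      if I = J then 1 else 0 := by
  classical
  calc
    _ = (Cσ 0 1 I la yy * Cσ 1 1 I la yy)⁻¹ *
        pairing la yy (I.1.image zz) (J.1.image zz) (List.ofFn zz) := by
      rw [← sum_listWplus_mul_listWminus_eq_pairing hz, Finset.mul_sum]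
      refine Finset.sum_congr rfl fun K _ => ?_
      rw [Wplus_one_comp_elt hz, Wminus_comp_elt hz, pairingDen_image hz]
      simp only [div_eq_mul_inv, mul_inv]
      ring
    _ = _ := by
      rw [pairing_eq_ite _ _ (List.nodup_ofFn.2 hz) (by simpa using hg)]
      simp only [forall_mem_ofFn_mem_image_iff hz, ← Cσ_one_mul_Cσ_one_eq_weightProd hz,
        mul_ite, inv_mul_cancel₀ hC, mul_zero]

end FieldOrthogonality

section Map

variable {A B : Type*} [CommRing A] [CommRing B] (f : A →+* B) {n k : ℕ}

lemma map_inverse_of_isUnit {a : A} (ha : IsUnit a) :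
    f (Ring.inverse a) = Ring.inverse (f a) := by
  obtain ⟨u, rfl⟩ := ha
  rw [Ring.inverse_unit]
  exact (Ring.inverse_unit (Units.map (f : A →* B) u)).symm

lemma map_W (I : II n k) (la : A) {t : Fin k → A} (zz : Fin n → A) (yy : A)
    (ht : ∀ a b, a ≠ b → IsUnit (t a - t b)) :
    f (W I la t zz yy) = W I (f la) (fun r => f (t r)) (fun a => f (zz a)) (f yy) := by
  rw [W, W, map_mul, map_pow, map_sum]
  congr 1
  refine Finset.sum_congr rfl fun σ _ => ?_
  simp only [weightTerm, map_mul, map_prod, lFactor, apply_ite f, map_add, map_sub, map_intCast]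
  congr 1
  refine Finset.prod_congr rfl fun a _ => Finset.prod_congr rfl fun b hb => ?_
  rw [map_inverse_of_isUnit f (ht _ _ fun h => (Finset.mem_Ioi.1 hb).ne (σ.injective h)), map_sub]

lemma map_e (t : Fin k → A) (yy : A) : f (e t yy) = e (fun r => f (t r)) (f yy) := by
  simp [e]

lemma map_Cσ (r : ℤ) (σ : Equiv.Perm (Fin n)) (I : II n k) (la yy : A) :
    f (Cσ r σ I la yy) = Cσ r σ I (f la) (f yy) := by
  simp [Cσ]

lemma map_Wplus (σ : Equiv.Perm (Fin n)) (I : II n k) {la : A} {t : Fin k → A} (zz : Fin n → A)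
    {yy : A} (ht : ∀ a b, a ≠ b → IsUnit (t a - t b))
    (hden : IsUnit (Cσ 0 σ I la yy * Cσ 1 σ I la yy * e t yy)) :
    f (Wplus σ I la t zz yy) = Wplus σ I (f la) (fun r => f (t r)) (fun a => f (zz a)) (f yy) := by
  simp only [Wplus, Wσ, map_mul, map_W f _ _ _ _ ht, map_inverse_of_isUnit f hden, map_Cσ, map_e]

lemma map_Wminus (I : II n k) (la : A) {t : Fin k → A} (zz : Fin n → A) {yy : A}
    (ht : ∀ a b, a ≠ b → IsUnit (t a - t b)) (he : IsUnit (e t yy)) :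
    f (Wminus I la t zz yy) = Wminus I (f la) (fun r => f (t r)) (fun a => f (zz a)) (f yy) := by
  simp only [Wminus, Wσ, map_mul, map_W f _ _ _ _ ht, map_inverse_of_isUnit f he, map_e, map_pow,
    map_neg, map_one, map_sub, map_intCast]

end Map

section Domain

variable {n : ℕ}

lemma denominators_le_nonZeroDivisors (n : ℕ) :
    denominators n ≤ nonZeroDivisors (Polynomial (P n)) := by
  rw [denominators, Submonoid.closure_le]
  rintro p ((⟨i, j, hij, rfl⟩ | ⟨i, j, rfl⟩) | ⟨l, rfl⟩)
  · refine mem_nonZeroDivisors_of_ne_zero (Polynomial.C_ne_zero.2 (sub_ne_zero.2 fun h => hij ?_))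
    exact Sum.inl_injective (MvPolynomial.X_injective h)
  · refine mem_nonZeroDivisors_of_ne_zero (Polynomial.C_ne_zero.2 fun h => ?_)
    have := congrArg (MvPolynomial.eval (Sum.elim (fun _ => (0 : ℂ)) fun _ => 1)) h
    simp [zP, yP] at this
  · exact mem_nonZeroDivisors_of_ne_zero (Polynomial.monic_X_add_C _).ne_zero

instance instIsDomainL (n : ℕ) : IsDomain (L n) :=
  IsLocalization.isDomain_of_le_nonZeroDivisors (L n) (denominators_le_nonZeroDivisors n)

lemma z_injective (n : ℕ) : Function.Injective (z : Fin n → L n) := fun a b h => by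
  by_contra hab
  exact (isUnit_sub hab).ne_zero (sub_eq_zero.2 h)

end Domain

section Orthogonality

variable {n k : ℕ}

lemma sum_Wplus_mul_Wminus (I J : II n k) :
    ∑ K : II n k, Wplus 1 I (lam n) (zAt K) z (y n) *
        (Wminus J (lam n) (zAt K) z (y n) * (Ring.inverse (R K) * Ring.inverse (Q K))) =
      if I = J then 1 else 0 := by
  classical
  let φ := algebraMap (L n) (FractionRing (L n))
  have hφ : Function.Injective φ := IsFractionRing.injective _ _
  have hsub (K : II n k) (a b : Fin k) (h : a ≠ b) : IsUnit (zAt K a - zAt K b) :=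
    isUnit_zAt_sub K h
  have hC : IsUnit (Cσ 0 1 I (lam n) (y n) * Cσ 1 1 I (lam n) (y n)) :=
    (isUnit_C 0 1 I).mul (isUnit_C 1 1 I)
  refine hφ (.trans ?_ <| (sum_Wplus_mul_Wminus_of_field (hφ.comp (z_injective n))
    (la := φ (lam n)) (yy := φ (y n)) (fun a b => ?_) I J ?_).trans ?_)
  · rw [map_sum]
    refine Finset.sum_congr rfl fun K _ => ?_
    rw [map_mul, map_mul, map_mul, map_Wplus φ 1 I z (hsub K) (hC.mul (isUnit_e K)),
      map_Wminus φ J (lam n) z (hsub K) (isUnit_e K), map_inverse_of_isUnit φ (isUnit_R K),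
      map_inverse_of_isUnit φ (isUnit_Q K), Ring.inverse_eq_inv']
    simp only [R, Q, map_prod, map_sub, map_add]
    rfl
  · simpa using ((isUnit_sub_add a b).map φ).ne_zero
  · simpa only [map_mul, map_Cσ] using (hC.map φ).ne_zero
  · rw [apply_ite φ, map_one, map_zero]

lemma sum_Wminus_mul_Wplus (K K' : II n k) :
    ∑ I : II n k, Wminus I (lam n) (zAt K) z (y n) * (Ring.inverse (R K) * Ring.inverse (Q K)) *
        Wplus 1 I (lam n) (zAt K') z (y n) = if K = K' then 1 else 0 := by
  let M : Matrix (II n k) (II n k) (L n) := fun I K => Wplus 1 I (lam n) (zAt K) z (y n)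
  let N : Matrix (II n k) (II n k) (L n) := fun K J =>
    Wminus J (lam n) (zAt K) z (y n) * (Ring.inverse (R K) * Ring.inverse (Q K))
  have hMN : M * N = 1 := by
    ext I J
    rw [Matrix.mul_apply, Matrix.one_apply, ← sum_Wplus_mul_Wminus]
  have hNM : N * M = 1 := mul_eq_one_comm.1 hMN
  rw [← Matrix.one_apply, ← hNM, Matrix.mul_apply]

end Orthogonality

section Generators

variable (R : Type*) [CommRing R] {ι σ τ κ : Type*} [Fintype ι]

/-- The monic polynomial `∏_i (u - X_{s(i)})` in `u`. For `s = Sum.inl` and `s = Sum.inr` these are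
the Chern polynomials of the tautological bundles on the Grassmannian. -/
def rootPoly (s : ι → κ) : Polynomial (MvPolynomial κ R) :=
  ∏ i, (Polynomial.X - Polynomial.C (MvPolynomial.X (s i)))

lemma rootPoly_monic (s : ι → κ) : (rootPoly R s).Monic :=
  Polynomial.monic_prod_X_sub_C _ _

lemma natDegree_rootPoly [Nontrivial R] (s : ι → κ) :
    (rootPoly R s).natDegree = Fintype.card ι :=
  Polynomial.natDegree_finsetProd_X_sub_C_eq_card _ _

variable {R}

lemma map_rootPoly {S : Type*} [CommRing S] (φ : MvPolynomial κ R →+* S) (s : ι → κ) :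
    (rootPoly R s).map φ =
      ∏ i, (Polynomial.X - Polynomial.C (φ (MvPolynomial.X (s i)))) := by
  simp only [rootPoly, Polynomial.map_prod, Polynomial.map_sub, Polynomial.map_X, Polynomial.map_C]

lemma rename_esymm_eq_coeff_rootPoly (s : ι → κ) {m : ℕ} (hm : m ≤ Fintype.card ι) :
    MvPolynomial.rename s (MvPolynomial.esymm ι R m) =
      (-1) ^ m * (rootPoly R s).coeff (Fintype.card ι - m) := by
  have hroot : rootPoly R s = ((Finset.univ.val.map fun i => (MvPolynomial.X (s i) :
      MvPolynomial κ R)).map fun x => Polynomial.X - Polynomial.C x).prod := by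
    rw [Multiset.map_map]
    rfl
  rw [hroot, Multiset.prod_X_sub_C_coeff _ (by simp), Multiset.card_map, Finset.card_val,
    Finset.card_univ, Nat.sub_sub_self hm, ← mul_assoc, ← mul_pow, neg_one_mul, neg_neg, one_pow,
    one_mul, ← MvPolynomial.aeval_esymm_eq_multiset_esymm ι R, MvPolynomial.rename_eq_aeval]
  rfl

lemma rename_esymm_mem_adjoin (s : ι → κ) {m : ℕ} (hm : m ≤ Fintype.card ι) :
    MvPolynomial.rename s (MvPolynomial.esymm ι R m) ∈
      Algebra.adjoin R (Set.range (rootPoly R s).coeff) := by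
  rw [rename_esymm_eq_coeff_rootPoly s hm]
  exact mul_mem (pow_mem (neg_mem (one_mem _)) _)
    (Algebra.subset_adjoin ⟨_, rfl⟩)

lemma rename_mem_adjoin_of_isSymmetric (s : ι → κ) {p : MvPolynomial ι R} (hp : p.IsSymmetric) :
    MvPolynomial.rename s p ∈ Algebra.adjoin R (Set.range (rootPoly R s).coeff) := by
  obtain ⟨q, hq⟩ := MvPolynomial.esymmAlgHom_surjective R le_rfl ⟨p, hp⟩
  replace hq : MvPolynomial.aeval (fun i : Fin (Fintype.card ι) =>
      MvPolynomial.esymm ι R (i + 1)) q = p := by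
    rw [← MvPolynomial.esymmAlgHom_apply, hq]
  rw [← hq, MvPolynomial.aeval_def, MvPolynomial.eval₂_eq', map_sum]
  simp only [map_mul, map_prod, map_pow, MvPolynomial.algebraMap_eq, MvPolynomial.rename_C]
  exact sum_mem fun d _ => mul_mem (Subalgebra.algebraMap_mem _ _)
    (prod_mem fun i _ => pow_mem (rename_esymm_mem_adjoin s i.2) _)

lemma sumAlgEquiv_rename_sumMap (s : σ → σ) (t : τ → τ) (f : MvPolynomial (σ ⊕ τ) R) :
    MvPolynomial.sumAlgEquiv R σ τ (MvPolynomial.rename (Sum.map s t) f) =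
      MvPolynomial.map (MvPolynomial.rename t).toRingHom
        (MvPolynomial.rename s (MvPolynomial.sumAlgEquiv R σ τ f)) := by
  induction f using MvPolynomial.induction_on with
  | C a => simp
  | add p q hp hq => simp only [map_add, hp, hq]
  | mul_X p i hp => cases i <;> simp_all

variable [Fintype σ]

lemma exists_aeval_esymm_of_rename_sumMap_eq {f : MvPolynomial (σ ⊕ τ) R}
    (hf : ∀ (s : Equiv.Perm σ) (t : Equiv.Perm τ), MvPolynomial.rename (Sum.map s t) f = f) :
    ∃ h : MvPolynomial (Fin (Fintype.card σ)) (MvPolynomial τ R),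
      (∀ d, (h.coeff d).IsSymmetric) ∧ MvPolynomial.sumAlgEquiv R σ τ f =
        MvPolynomial.aeval (fun i : Fin (Fintype.card σ) =>
          MvPolynomial.esymm σ (MvPolynomial τ R) (i + 1)) h := by
  have hsymm : (MvPolynomial.sumAlgEquiv R σ τ f).IsSymmetric := fun s => by
    conv_rhs => rw [← hf s 1, sumAlgEquiv_rename_sumMap]
    rw [Equiv.Perm.coe_one, MvPolynomial.rename_id]
    exact (MvPolynomial.map_id _).symm
  obtain ⟨h, hh⟩ := MvPolynomial.esymmAlgHom_surjective (MvPolynomial τ R) le_rfl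
    ⟨MvPolynomial.sumAlgEquiv R σ τ f, hsymm⟩
  replace hh : MvPolynomial.aeval (fun i : Fin (Fintype.card σ) =>
      MvPolynomial.esymm σ (MvPolynomial τ R) (i + 1)) h = MvPolynomial.sumAlgEquiv R σ τ f := by
    rw [← MvPolynomial.esymmAlgHom_apply, hh]
  refine ⟨h, fun d t => ?_, hh.symm⟩
  suffices hmap : MvPolynomial.map (MvPolynomial.rename t).toRingHom h = h by
    conv_rhs => rw [← hmap, MvPolynomial.coeff_map]
    rfl
  refine MvPolynomial.esymmAlgHom_injective (MvPolynomial τ R) le_rfl (Subtype.ext ?_)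
  rw [MvPolynomial.esymmAlgHom_apply, MvPolynomial.esymmAlgHom_apply, hh, ← hf 1 t,
    sumAlgEquiv_rename_sumMap, Equiv.Perm.coe_one, MvPolynomial.rename_id_apply, ← hh]
  have hC : (MvPolynomial.map (MvPolynomial.rename t).toRingHom).comp
      (algebraMap (MvPolynomial τ R) (MvPolynomial σ (MvPolynomial τ R))) =
      (algebraMap _ _).comp (MvPolynomial.rename t).toRingHom :=
    RingHom.ext fun p => MvPolynomial.map_C _ p
  rw [MvPolynomial.map_aeval, hC, MvPolynomial.aeval_def, MvPolynomial.eval₂_map]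
  simp only [MvPolynomial.map_esymm, MvPolynomial.coe_eval₂Hom]

lemma mem_adjoin_of_rename_sumMap_eq [Fintype τ] {f : MvPolynomial (σ ⊕ τ) R}
    (hf : ∀ (s : Equiv.Perm σ) (t : Equiv.Perm τ), MvPolynomial.rename (Sum.map s t) f = f) :
    f ∈ Algebra.adjoin R (Set.range (rootPoly R (Sum.inl : σ → σ ⊕ τ)).coeff ∪
      Set.range (rootPoly R (Sum.inr : τ → σ ⊕ τ)).coeff) := by
  obtain ⟨h, hsymm, hh⟩ := exists_aeval_esymm_of_rename_sumMap_eq hf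
  rw [← (MvPolynomial.sumAlgEquiv R σ τ).symm_apply_apply f, hh, MvPolynomial.aeval_def,
    MvPolynomial.eval₂_eq', map_sum]
  refine sum_mem fun d _ => ?_
  rw [map_mul, map_prod]
  refine mul_mem ?_ (prod_mem fun i _ => ?_)
  · have hcoeff : (MvPolynomial.sumAlgEquiv R σ τ).symm (MvPolynomial.C (h.coeff d)) =
        MvPolynomial.rename Sum.inr (h.coeff d) := by
      rw [AlgEquiv.symm_apply_eq]
      exact (AlgHom.congr_fun (MvPolynomial.sumAlgEquiv_comp_rename_inr R σ τ) _).symm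
    rw [MvPolynomial.algebraMap_eq, hcoeff]
    exact Algebra.adjoin_mono Set.subset_union_right
      (rename_mem_adjoin_of_isSymmetric Sum.inr (hsymm d))
  · have hesymm : (MvPolynomial.sumAlgEquiv R σ τ).symm
        (MvPolynomial.esymm σ (MvPolynomial τ R) (i + 1)) =
        MvPolynomial.rename Sum.inl (MvPolynomial.esymm σ R (i + 1)) := by
      rw [AlgEquiv.symm_apply_eq, ← MvPolynomial.map_esymm σ R _ (algebraMap R (MvPolynomial τ R))]
      exact (AlgHom.congr_fun (MvPolynomial.sumAlgEquiv_comp_rename_inl R σ τ) _).symm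
    rw [map_pow, hesymm]
    exact Algebra.adjoin_mono Set.subset_union_left
      (pow_mem (rename_esymm_mem_adjoin Sum.inl i.2) _)

end Generators

section Factorization

open Polynomial

variable {S ι : Type*} [CommRing S] {x : ι → S}

lemma C_mul_eq_zero_of_degree_lt_card (hx : Pairwise fun i j => IsUnit (x i - x j))
    {s : Finset ι} {c : S} {p : S[X]} (hdeg : p.degree < s.card)
    (hc : ∀ i ∈ s, c * p.eval (x i) = 0) : C c * p = 0 := by
  nontriviality S
  have hdvd : ∏ i ∈ s, (X - C (x i)) ∣ C c * p :=
    Finset.prod_dvd_of_coprime (fun i _ j _ hij => isCoprime_X_sub_C_of_isUnit_sub (hx hij))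
      fun i hi => dvd_iff_isRoot.2 (by rw [IsRoot, eval_mul, eval_C, hc i hi])
  by_contra hne
  refine (monic_prod_X_sub_C x s).not_dvd_of_degree_lt hne ?_ hdvd
  rw [degree_eq_natDegree (monic_prod_X_sub_C x s).ne_zero, natDegree_finsetProd_X_sub_C_eq_card,
    C_mul']
  exact (degree_smul_le _ _).trans_lt hdeg

lemma C_mul_eq_C_mul_prod (hx : Pairwise fun i j => IsUnit (x i - x j)) {s : Finset ι} {p : S[X]}
    (hp : p.Monic) (hdeg : p.natDegree = s.card) {c : S} (hc : ∀ i ∈ s, c * p.eval (x i) = 0) :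
    C c * p = C c * ∏ i ∈ s, (X - C (x i)) := by
  nontriviality S
  have hq : (∏ i ∈ s, (X - C (x i))).Monic := monic_prod_X_sub_C x s
  have hpq : p.degree = (∏ i ∈ s, (X - C (x i))).degree := by
    rw [degree_eq_natDegree hp.ne_zero, degree_eq_natDegree hq.ne_zero, hdeg,
      natDegree_finsetProd_X_sub_C_eq_card]
  rw [← sub_eq_zero, ← mul_sub]
  refine C_mul_eq_zero_of_degree_lt_card hx (s := s) ?_ fun i hi => ?_
  · refine (degree_sub_lt_left hpq hp.ne_zero (hp.trans hq.symm)).trans_eq ?_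
    rw [degree_eq_natDegree hp.ne_zero, hdeg]
  · rw [eval_sub, eval_prod, Finset.prod_eq_zero hi (by simp), sub_zero, hc i hi]

variable [Fintype ι] {A B : S[X]}

lemma natDegree_add_natDegree_eq_card [Nontrivial S] (hAB : A * B = ∏ i, (X - C (x i)))
    (hA : A.Monic) (hB : B.Monic) : A.natDegree + B.natDegree = Fintype.card ι := by
  rw [← hA.natDegree_mul hB, hAB, natDegree_finsetProd_X_sub_C_eq_card, Finset.card_univ]

lemma eval_mul_eval_eq_zero (hAB : A * B = ∏ i, (X - C (x i))) (i : ι) :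
    A.eval (x i) * B.eval (x i) = 0 := by
  rw [← eval_mul, hAB, eval_prod, Finset.prod_eq_zero (Finset.mem_univ i) (by simp)]

lemma prod_eval_mul_eval_eq_zero (hAB : A * B = ∏ i, (X - C (x i))) {K : Finset ι} {i : ι}
    (hi : i ∈ K) : (∏ j ∈ K, A.eval (x j)) * B.eval (x i) = 0 := by
  classical
  rw [← Finset.mul_prod_erase K _ hi, mul_right_comm, eval_mul_eval_eq_zero hAB, zero_mul]

variable (hx : Pairwise fun i j => IsUnit (x i - x j)) (hAB : A * B = ∏ i, (X - C (x i)))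

include hx hAB

lemma prod_eval_eq_zero_of_natDegree_lt (hB : B.Monic) {K : Finset ι}
    (hK : B.natDegree < K.card) : ∏ j ∈ K, A.eval (x j) = 0 := by
  nontriviality S
  rw [← C_eq_zero, ← hB.mul_left_eq_zero_iff]
  refine C_mul_eq_zero_of_degree_lt_card hx (s := K) ?_ fun i hi =>
    prod_eval_mul_eval_eq_zero hAB hi
  rw [degree_eq_natDegree hB.ne_zero]
  exact_mod_cast hK

variable [DecidableEq ι]

lemma C_prod_compl_eval_mul_left (hA : A.Monic) (hB : B.Monic) {J : Finset ι}
    (hAJ : A.natDegree = J.card) (hBJ : B.natDegree = Jᶜ.card) :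
    C (∏ j ∈ Jᶜ, A.eval (x j)) * A =
      C (∏ j ∈ Jᶜ, A.eval (x j)) * ∏ i ∈ J, (X - C (x i)) := by
  refine C_mul_eq_C_mul_prod hx hA hAJ fun i hi => ?_
  have hiJ : i ∉ Jᶜ := by simpa using hi
  rw [mul_comm, ← Finset.prod_insert (f := fun j => A.eval (x j)) hiJ]
  exact prod_eval_eq_zero_of_natDegree_lt hx hAB hB
    (by rw [Finset.card_insert_of_notMem hiJ, hBJ]; exact Nat.lt_succ_self _)

lemma C_prod_compl_eval_mul_right (hB : B.Monic) {J : Finset ι} (hBJ : B.natDegree = Jᶜ.card) :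
    C (∏ j ∈ Jᶜ, A.eval (x j)) * B =
      C (∏ j ∈ Jᶜ, A.eval (x j)) * ∏ i ∈ Jᶜ, (X - C (x i)) :=
  C_mul_eq_C_mul_prod hx hB hBJ fun _ hi => prod_eval_mul_eval_eq_zero hAB hi

lemma eq_zero_of_prod_compl_eval_mul_eq_zero (hA : A.Monic) (hB : B.Monic) {f : S}
    (hf : ∀ J : Finset ι, J.card = A.natDegree → (∏ j ∈ Jᶜ, A.eval (x j)) * f = 0) : f = 0 := by
  nontriviality S
  have hcard := natDegree_add_natDegree_eq_card hAB hA hB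
  suffices h : ∀ (d : ℕ) (K : Finset ι), K.card + d = B.natDegree →
      (∏ j ∈ K, A.eval (x j)) * f = 0 by
    simpa using h B.natDegree ∅ (by simp)
  intro d
  induction d with
  | zero =>
    intro K hK
    have := hf Kᶜ (by rw [Finset.card_compl]; omega)
    rwa [compl_compl] at this
  | succ d ih =>
    intro K hK
    rw [← C_eq_zero, ← hA.mul_left_eq_zero_iff]
    refine C_mul_eq_zero_of_degree_lt_card hx (s := Kᶜ) ?_ fun i hi => ?_
    · rw [degree_eq_natDegree hA.ne_zero, Finset.card_compl]
      exact_mod_cast (by omega : A.natDegree < Fintype.card ι - K.card)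
    · have hiK : i ∉ K := by simpa using hi
      have := ih (insert i K) (by rw [Finset.card_insert_of_notMem hiK]; omega)
      rw [Finset.prod_insert hiK] at this
      linear_combination this

end Factorization

section Localization

variable {n k : ℕ}

lemma mul_eq_mul_of_adjoin_eq_top {R A B : Type*} [CommRing R] [CommRing A] [CommRing B]
    [Algebra R A] [Algebra R B] (φ ψ : A →ₐ[R] B) (c : B) {s : Set A}
    (hs : Algebra.adjoin R s = ⊤) (h : ∀ a ∈ s, c * φ a = c * ψ a) (a : A) :
    c * φ a = c * ψ a := by
  have ha : a ∈ Algebra.adjoin R s := hs ▸ Algebra.mem_top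
  induction ha using Algebra.adjoin_induction with
  | mem a ha => exact h a ha
  | algebraMap r => rw [AlgHom.commutes, AlgHom.commutes]
  | add a b _ _ ha hb => rw [map_add, map_add, mul_add, mul_add, ha, hb]
  | mul a b _ _ ha hb =>
    rw [map_mul, map_mul]
    linear_combination φ b * ha + ψ a * hb

lemma exists_map_val_eq {p : Polynomial (PΓ n k)}
    (hp : ∀ (s : Equiv.Perm (Fin k)) (t : Equiv.Perm (Fin (n - k))),
      p.map (MvPolynomial.rename (R := P n) (Sum.map s t)).toRingHom = p) :
    ∃ q : Polynomial (invariants n k), q.map (invariants n k).val.toRingHom = p := by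
  refine (Polynomial.mem_lifts _).1 ((Polynomial.lifts_iff_coeff_lifts p).2 fun m => ?_)
  refine ⟨⟨p.coeff m, fun s t => ?_⟩, rfl⟩
  conv_rhs => rw [← hp s t, Polynomial.coeff_map]
  rfl

lemma exists_map_val_eq_rootPoly_inl (n k : ℕ) : ∃ q : Polynomial (invariants n k),
    q.map (invariants n k).val.toRingHom = rootPoly (P n) Sum.inl :=
  exists_map_val_eq fun s t => by
    simp only [map_rootPoly, AlgHom.toRingHom_eq_coe, RingHom.coe_coe, MvPolynomial.rename_X,
      Sum.map_inl]
    exact Equiv.prod_comp s fun i : Fin k => (Polynomial.X - Polynomial.C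
      (MvPolynomial.X (Sum.inl i)) : Polynomial (PΓ n k))

lemma exists_map_val_eq_rootPoly_inr (n k : ℕ) : ∃ q : Polynomial (invariants n k),
    q.map (invariants n k).val.toRingHom = rootPoly (P n) Sum.inr :=
  exists_map_val_eq fun s t => by
    simp only [map_rootPoly, AlgHom.toRingHom_eq_coe, RingHom.coe_coe, MvPolynomial.rename_X,
      Sum.map_inr]
    exact Equiv.prod_comp t fun i : Fin (n - k) => (Polynomial.X - Polynomial.C
      (MvPolynomial.X (Sum.inr i)) : Polynomial (PΓ n k))

/-- The polynomial `∏ (u - γ_{1,i})`, which is the Chern polynomial of the tautological bundle, over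
the ring of invariants. -/
def subPoly (n k : ℕ) : Polynomial (invariants n k) := (exists_map_val_eq_rootPoly_inl n k).choose

/-- The polynomial `∏ (u - γ_{2,j})`, which is the Chern polynomial of the quotient bundle, over
the ring of invariants. -/
def quotPoly (n k : ℕ) : Polynomial (invariants n k) := (exists_map_val_eq_rootPoly_inr n k).choose

lemma map_val_subPoly (n k : ℕ) :
    (subPoly n k).map (invariants n k).val.toRingHom = rootPoly (P n) Sum.inl :=
  (exists_map_val_eq_rootPoly_inl n k).choose_spec

lemma map_val_quotPoly (n k : ℕ) :
    (quotPoly n k).map (invariants n k).val.toRingHom = rootPoly (P n) Sum.inr :=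
  (exists_map_val_eq_rootPoly_inr n k).choose_spec

lemma val_injective (n k : ℕ) : Function.Injective (invariants n k).val.toRingHom :=
  Subtype.val_injective

lemma subPoly_monic (n k : ℕ) : (subPoly n k).Monic :=
  Polynomial.monic_of_injective (val_injective n k)
    (by rw [map_val_subPoly]; exact rootPoly_monic _ _)

lemma quotPoly_monic (n k : ℕ) : (quotPoly n k).Monic :=
  Polynomial.monic_of_injective (val_injective n k)
    (by rw [map_val_quotPoly]; exact rootPoly_monic _ _)

lemma natDegree_subPoly (n k : ℕ) : (subPoly n k).natDegree = k := by
  rw [← Polynomial.natDegree_map_eq_of_injective (val_injective n k), map_val_subPoly,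
    natDegree_rootPoly, Fintype.card_fin]

lemma natDegree_quotPoly (n k : ℕ) : (quotPoly n k).natDegree = n - k := by
  rw [← Polynomial.natDegree_map_eq_of_injective (val_injective n k), map_val_quotPoly,
    natDegree_rootPoly, Fintype.card_fin]

lemma adjoin_coeff_subPoly_union_coeff_quotPoly (n k : ℕ) :
    Algebra.adjoin (P n) (Set.range (subPoly n k).coeff ∪ Set.range (quotPoly n k).coeff) = ⊤ := by
  refine eq_top_iff.2 fun f _ => ?_
  have hf := mem_adjoin_of_rename_sumMap_eq f.2
  have hcoeff (q : Polynomial (invariants n k)) : (invariants n k).val '' Set.range q.coeff =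
      Set.range (q.map (invariants n k).val.toRingHom).coeff := by
    rw [← Set.range_comp]
    congr 1
    funext m
    exact (Polynomial.coeff_map _ m).symm
  rw [← map_val_subPoly, ← map_val_quotPoly, ← hcoeff, ← hcoeff, ← Set.image_union,
    ← AlgHom.map_adjoin] at hf
  obtain ⟨g, hg, hgf⟩ := hf
  rwa [← Subtype.ext hgf]

/-- The homomorphism `f ↦ 1 ⊗ [f]`. -/
def oneTmulCls (n k : ℕ) : invariants n k →ₐ[P n] HL n k :=
  Algebra.TensorProduct.includeRight.comp
    (Ideal.Quotient.mkₐ (P n) (Ideal.span (Set.range (relation n k))))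

lemma oneTmulCls_apply (f : invariants n k) : oneTmulCls n k f = 1 ⊗ₜ cls f := rfl

lemma oneTmulCls_relation (m : ℕ) : oneTmulCls n k (relation n k m) = 0 := by
  have : cls (relation n k m) = 0 :=
    Ideal.Quotient.eq_zero_iff_mem.2 (Ideal.subset_span ⟨m, rfl⟩)
  rw [oneTmulCls_apply, this, TensorProduct.tmul_zero]

/-- The coordinate `z_a` as an element of `H^*_T(T^*Gr_k(ℂⁿ)) ⊗ 𝓛_{λ,z,y}`. -/
def zHL (n k : ℕ) (a : Fin n) : HL n k := algebraMap (P n) (HL n k) (zP a)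

lemma isUnit_zHL_sub : Pairwise fun i j => IsUnit (zHL n k i - zHL n k j) := fun i j hij => by
  have := (isUnit_sub (n := n) hij).map (algebraMap (L n) (HL n k))
  rwa [map_sub, z, z, ← IsScalarTower.algebraMap_apply, ← IsScalarTower.algebraMap_apply] at this

/-- The Chern polynomial of the tautological bundle over `H^*_T(T^*Gr_k(ℂⁿ)) ⊗ 𝓛_{λ,z,y}`. -/
def subPolyHL (n k : ℕ) : Polynomial (HL n k) := (subPoly n k).map (oneTmulCls n k).toRingHom

/-- The Chern polynomial of the quotient bundle over `H^*_T(T^*Gr_k(ℂⁿ)) ⊗ 𝓛_{λ,z,y}`. -/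
def quotPolyHL (n k : ℕ) : Polynomial (HL n k) := (quotPoly n k).map (oneTmulCls n k).toRingHom

lemma coeff_subPoly_mul_quotPoly_sub (m : ℕ) :
    (subPoly n k * quotPoly n k - ∏ a, (Polynomial.X - Polynomial.C
      (algebraMap (P n) (invariants n k) (zP a)))).coeff m = relation n k m := by
  refine val_injective n k ?_
  rw [← Polynomial.coeff_map]
  simp only [Polynomial.map_sub, Polynomial.map_mul, Polynomial.map_prod, map_val_subPoly,
    map_val_quotPoly, Polynomial.map_X, Polynomial.map_C]
  rfl

lemma subPolyHL_mul_quotPolyHL (n k : ℕ) :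
    subPolyHL n k * quotPolyHL n k = ∏ a, (Polynomial.X - Polynomial.C (zHL n k a)) := by
  have hz (a : Fin n) : (oneTmulCls n k).toRingHom (algebraMap (P n) (invariants n k) (zP a)) =
      zHL n k a := (oneTmulCls n k).commutes _
  have h : (subPoly n k * quotPoly n k - ∏ a, (Polynomial.X - Polynomial.C
      (algebraMap (P n) (invariants n k) (zP a)))).map (oneTmulCls n k).toRingHom = 0 := by
    ext m
    rw [Polynomial.coeff_map, coeff_subPoly_mul_quotPoly_sub]
    exact oneTmulCls_relation m
  rw [← sub_eq_zero, ← h]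
  simp only [subPolyHL, quotPolyHL, Polynomial.map_sub, Polynomial.map_mul, Polynomial.map_prod,
    Polynomial.map_X, Polynomial.map_C, hz]

/-- The class `∏_{a ∉ I} ∏_i (z_a - γ_{1,i})`, which is supported at the fixed point `x_I`. -/
def pointClass (I : II n k) : HL n k := ∏ a ∈ I.1ᶜ, (subPolyHL n k).eval (zHL n k a)

lemma subPolyHL_monic (n k : ℕ) : (subPolyHL n k).Monic := (subPoly_monic n k).map _

lemma quotPolyHL_monic (n k : ℕ) : (quotPolyHL n k).Monic := (quotPoly_monic n k).map _

/-- Evaluation of invariant polynomials at the fixed point `x_I`, with values in constant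
classes. -/
def evalAt (I : II n k) : invariants n k →ₐ[P n] HL n k :=
  (Algebra.ofId (P n) (HL n k)).comp ((subst I).comp (invariants n k).val)

lemma map_evalAt (I : II n k) (q : Polynomial (invariants n k)) :
    q.map (evalAt I).toRingHom = ((q.map (invariants n k).val.toRingHom).map
      (subst I).toRingHom).map (algebraMap (P n) (HL n k)) := by
  rw [Polynomial.map_map, Polynomial.map_map]
  rfl

lemma map_evalAt_subPoly (I : II n k) : (subPoly n k).map (evalAt I).toRingHom =
    ∏ a ∈ I.1, (Polynomial.X - Polynomial.C (zHL n k a)) := by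
  rw [map_evalAt, map_val_subPoly, map_rootPoly, Polynomial.map_prod,
    ← prod_elt I fun a => (Polynomial.X - Polynomial.C (zHL n k a))]
  simp [subst, zHL]

lemma map_evalAt_quotPoly (I : II n k) : (quotPoly n k).map (evalAt I).toRingHom =
    ∏ a ∈ I.1ᶜ, (Polynomial.X - Polynomial.C (zHL n k a)) := by
  have := prod_elt (compl I) fun a => (Polynomial.X - Polynomial.C (zHL n k a))
  rw [compl] at this
  rw [map_evalAt, map_val_quotPoly, map_rootPoly, Polynomial.map_prod, ← this]
  simp [subst, zHL, compl]

lemma pointClass_mul_oneTmulCls [Nontrivial (HL n k)] (I : II n k) (f : invariants n k) :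
    pointClass I * oneTmulCls n k f = pointClass I * evalAt I f := by
  have hsub : (subPolyHL n k).natDegree = I.1.card := by
    rw [subPolyHL, (subPoly_monic n k).natDegree_map, natDegree_subPoly, I.2]
  have hquot : (quotPolyHL n k).natDegree = I.1ᶜ.card := by
    rw [quotPolyHL, (quotPoly_monic n k).natDegree_map, natDegree_quotPoly, Finset.card_compl, I.2,
      Fintype.card_fin]
  have hprod := subPolyHL_mul_quotPolyHL n k
  refine mul_eq_mul_of_adjoin_eq_top _ _ _ (adjoin_coeff_subPoly_union_coeff_quotPoly n k) ?_ f
  rintro _ (⟨m, rfl⟩ | ⟨m, rfl⟩)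
  · have h := congrArg (fun p => p.coeff m) (C_prod_compl_eval_mul_left isUnit_zHL_sub hprod
      (subPolyHL_monic n k) (quotPolyHL_monic n k) hsub hquot)
    rw [← map_evalAt_subPoly] at h
    simpa only [pointClass, subPolyHL, Polynomial.coeff_C_mul, Polynomial.coeff_map,
      AlgHom.toRingHom_eq_coe, RingHom.coe_coe] using h
  · have h := congrArg (fun p => p.coeff m) (C_prod_compl_eval_mul_right isUnit_zHL_sub hprod
      (quotPolyHL_monic n k) hquot)
    rw [← map_evalAt_quotPoly] at h
    simpa only [pointClass, quotPolyHL, Polynomial.coeff_C_mul, Polynomial.coeff_map,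
      AlgHom.toRingHom_eq_coe, RingHom.coe_coe] using h

lemma pointClass_mul [Nontrivial (HL n k)] (I : II n k) (x : HL n k) :
    pointClass I * x = restr I x • pointClass I := by
  induction x using TensorProduct.induction_on with
  | zero => rw [mul_zero, map_zero, zero_smul]
  | add x y hx hy => rw [mul_add, map_add, add_smul, hx, hy]
  | tmul c f =>
    obtain ⟨f, rfl⟩ := Ideal.Quotient.mk_surjective f
    change pointClass I * c ⊗ₜ cls f = restr I (c ⊗ₜ cls f) • pointClass I
    have hc : c ⊗ₜ cls f = c • oneTmulCls n k f := by
      rw [oneTmulCls_apply, TensorProduct.smul_tmul', smul_eq_mul, mul_one]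
    have heval : evalAt I f = algebraMap (L n) (HL n k) (algebraMap (P n) (L n) (subst I f)) :=
      IsScalarTower.algebraMap_apply (P n) (L n) (HL n k) _
    rw [restr_tmul, hc, mul_smul_comm, pointClass_mul_oneTmulCls, heval, mul_smul,
      Algebra.smul_def (algebraMap (P n) (L n) _), mul_comm (pointClass I)]

lemma eq_of_restr_eq {x y : HL n k} (h : ∀ I, restr I x = restr I y) : x = y := by
  nontriviality HL n k
  refine sub_eq_zero.1 (eq_zero_of_prod_compl_eval_mul_eq_zero isUnit_zHL_sub
    (subPolyHL_mul_quotPolyHL n k) (subPolyHL_monic n k) (quotPolyHL_monic n k) fun J hJ => ?_)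
  rw [subPolyHL, (subPoly_monic n k).natDegree_map, natDegree_subPoly] at hJ
  change pointClass ⟨J, hJ⟩ * (x - y) = 0
  rw [pointClass_mul, map_sub, h, sub_self, zero_smul]

end Localization

section Main

variable {n : ℕ}

lemma nu_incl (k : Fin (n + 1)) (x : HL n k) :
    nu n (incl k x) = ∑ I : II n k, (restr I x * Ring.inverse (R I)) • xi I := by
  simp only [nu, incl, LinearMap.sum_apply, LinearMap.smulRight_apply, LinearMap.comp_apply,
    LinearMap.proj_apply, LinearMap.single_apply, AlgHom.toLinearMap_apply, mul_smul]
  rw [Finset.sum_eq_single_of_mem k (Finset.mem_univ k)]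
  · simp
  · intro k' _ hk
    simp [Pi.single_eq_of_ne hk]

lemma nu_Stab_v {k : Fin (n + 1)} (I : II n k) : nu n (Stab 1 (v I.1)) = v I.1 := by
  rw [Stab_v, nu_incl]
  simp only [restr_kappa, xi, Finset.smul_sum, smul_smul]
  rw [Finset.sum_comm]
  have h (J : II n k) : ∑ K : II n k, (Wplus 1 I (lam n) (zAt K) z (y n) * Ring.inverse (R K) *
      (Ring.inverse (Q K) * Wminus J (lam n) (zAt K) z (y n))) • v J.1 =
        (if I = J then (1 : L n) else 0) • v J.1 := by
    rw [← Finset.sum_smul, ← sum_Wplus_mul_Wminus]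
    congr 1
    exact Finset.sum_congr rfl fun K _ => by ring
  simp [Finset.sum_congr rfl fun J _ => h J]

lemma Stab_xi (k : Fin (n + 1)) (I : II n k) :
    Stab 1 (xi I) = incl k (1 ⊗ₜ[P n] cls (fixedPoly I)) := by
  simp only [xi, map_smul, map_sum, Stab_v]
  simp only [← map_smul, ← map_sum]
  congr 1
  refine eq_of_restr_eq fun J => ?_
  simp only [map_smul, map_sum, restr_kappa, restr_tmul, one_mul, smul_eq_mul, subst_fixedPoly]
  calc
    _ = R I * ∑ K : II n k, Wminus K (lam n) (zAt I) z (y n) *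
          (Ring.inverse (R I) * Ring.inverse (Q I)) * Wplus 1 K (lam n) (zAt J) z (y n) := by
      rw [Finset.mul_sum, Finset.mul_sum]
      refine Finset.sum_congr rfl fun K _ => ?_
      linear_combination (-(Ring.inverse (Q I) * Wminus K (lam n) (zAt I) z (y n) *
        Wplus 1 K (lam n) (zAt J) z (y n))) * Ring.mul_inverse_cancel _ (isUnit_R I)
    _ = _ := by rw [sum_Wminus_mul_Wplus, mul_ite, mul_one, mul_zero]

lemma Stab_nu_incl (k : Fin (n + 1)) (x : HL n k) : Stab 1 (nu n (incl k x)) = incl k x := by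
  simp only [nu_incl, map_sum, map_smul, Stab_xi]
  simp only [← map_smul, ← map_sum]
  congr 1
  refine eq_of_restr_eq fun J => ?_
  simp only [map_smul, map_sum, restr_tmul, one_mul, smul_eq_mul, subst_fixedPoly, mul_ite,
    mul_zero, Finset.sum_ite_eq', Finset.mem_univ, if_true]
  rw [mul_assoc, Ring.inverse_mul_cancel _ (isUnit_R J), mul_one]

end Main

end DynStab

end

theorem mainTheorem4 (n : ℕ) :
    (∀ (k : Fin (n + 1)) (c : DynStab.L n) (f : DynStab.invariants n k),
      DynStab.nu n (DynStab.incl k (c ⊗ₜ[DynStab.P n] DynStab.cls f)) =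
        ∑ I : DynStab.II n k,
          (c * algebraMap (DynStab.P n) (DynStab.L n) (DynStab.subst I f.1) *
            Ring.inverse (DynStab.R I)) • DynStab.xi I) ∧
    DynStab.nu n ∘ₗ DynStab.Stab 1 = LinearMap.id ∧
    DynStab.Stab 1 ∘ₗ DynStab.nu n = LinearMap.id ∧
    ∀ (k : Fin (n + 1)) (I : DynStab.II n k),
      DynStab.Stab 1 (DynStab.xi I) =
        DynStab.incl k (1 ⊗ₜ[DynStab.P n] DynStab.cls (DynStab.fixedPoly I)) := by
  refine ⟨fun k c f => ?_, ?_, ?_, DynStab.Stab_xi⟩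
  · rw [DynStab.nu_incl]
    simp only [DynStab.restr_tmul]
  · refine (DynStab.vBasis n).ext fun I => ?_
    rw [DynStab.vBasis_apply, LinearMap.comp_apply, LinearMap.id_apply]
    exact DynStab.nu_Stab_v (k := DynStab.size I) ⟨I, rfl⟩
  · refine LinearMap.pi_ext' fun k => LinearMap.ext fun x => ?_
    exact DynStab.Stab_nu_incl k x
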